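/- Let $A$ be a field of characteristic $0$, let $G$ be an $l$-group (a Hausdorff topological group in which the open compact subgroups form a fundamental system of neighbourhoods of the identity), and let $L\subset G$ be an open compact subgroup. For a field $k$, a $(k,G)$-module is a $k$-vector space with a $k$-linear action of $G$ in which every vector has an open stabilizer; it is irreducible if it is nonzero and has no $G$-stable subspaces other than $0$ and itself, and absolutely irreducible if $E\otimes_k X$ is irreducible for every field extension $E/k$. Let $\mathcal H(G,L,k)$ denote the Hecke algebra of $L$-biinvariant compactly supported functions $G\to k$ under convolution; it acts on the space $X^L$ of $L$-fixed vectors of any $(k,G)$-module $X$. Let $V$ be an irreducible $(A,G)$-module such that $V^L$ is nonzero and finite-dimensional over $A$ (finite-dimensionality is automatic when $V$ is $A$-admissible). Then $D=\mathrm{End}_{(A,G)}(V)$ is a division algebra, its center $K$ is a field, and evaluation of endomorphisms makes $V$ into a $(K,G)$-module $V^{ext}$. For every field extension $B/K$ there is an irreducible $(B,G)$-module $V(B)$ such that (i) $V(B)^L\neq 0$; (ii) $V(B)^L$ is finite-dimensional over $B$ and is an irreducible $\mathcal H(G,L,B)$-module; (iii) $B\otimes_K V^{ext}$ is isomorphic,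 as a $(B,G)$-module, to a direct sum of finitely many copies of $V(B)$; and $V(B)$ is unique up to isomorphism: every irreducible $(B,G)$-module satisfying (iii) is isomorphic to it. Moreover, every maximal subfield $F$ of $D$ contains $K$, and for such $F$ the $(F,G)$-module $V(F)$ is absolutely irreducible. -/

import Mathlib

open scoped TensorProduct

universe uE uA uG uV uB uX uY

/-- An `l`-group: a Hausdorff topological group in which the open compact subgroups form a
fundamental system of neighbourhoods of the unit element. -/
class IsLGroup (G : Type uG) [Group G] [TopologicalSpace G] : Prop
    extends IsTopologicalGroup G, T2Space G where
  exists_open_compact : ∀ U ∈ nhds (1 : G), ∃ H : Subgroup G,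
    IsOpen (H : Set G) ∧ IsCompact (H : Set G) ∧ (H : Set G) ⊆ U

section Rep

variable {G : Type uG} [Group G]

/-- Every vector has an open stabilizer. A `(k, G)`-module is a `k`-module `X` together with a
representation of `G` on `X` that is smooth in this sense. -/
def IsSmoothRep {k : Type*} [CommSemiring k] [TopologicalSpace G] {X : Type*} [AddCommMonoid X]
    [Module k X] (ρ : Representation k G X) : Prop :=
  ∀ v : X, IsOpen {g : G | ρ g v = v}

/-- The space `X^L` of vectors fixed by a subgroup `L`. -/
noncomputable def fixedVectors {k : Type*} [CommRing k] {X : Type*} [AddCommGroup X] [Module k X]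
    (ρ : Representation k G X) (L : Subgroup G) : Submodule k X :=
  Representation.invariants (MonoidHom.comp ρ L.subtype : Representation k L X)

/-- The base change `B ⊗ X` of a representation over `k` to a `k`-algebra `B`, with `G` acting on
the second factor. -/
noncomputable def baseChangeRep {k : Type*} [CommRing k] (B : Type*) [CommRing B] [Algebra k B]
    {X : Type*} [AddCommGroup X] [Module k X] (ρ : Representation k G X) :
    Representation B G (B ⊗[k] X) :=
  MonoidHom.comp (Module.End.baseChangeHom k B X : Module.End k X →* Module.End B (B ⊗[k] X)) ρ

/-- A representation over a field `k` is absolutely irreducible if its base change to every field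
extension of `k` is irreducible. -/
def IsAbsolutelyIrreducible {k : Type uB} [Field k] {X : Type uX} [AddCommGroup X] [Module k X]
    (ρ : Representation k G X) : Prop :=
  ∀ (E : Type uE) [Field E] [Algebra k E], (baseChangeRep E ρ).IsIrreducible

/-- `ρ` is isomorphic to the direct sum of `n` copies of `σ`. -/
def IsSumOfCopies {k : Type*} [CommRing k] {X Y : Type*} [AddCommGroup X] [Module k X]
    [AddCommGroup Y] [Module k Y] (ρ : Representation k G X) (σ : Representation k G Y)
    (n : ℕ) : Prop :=
  Nonempty (ρ.Equiv (Representation.directSum fun _ : Fin n => σ))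

variable {A : Type uA} [Field A] {V : Type uV} [AddCommGroup V] [Module A V]

/-- The `A`-algebra `End_{(A, G)}(V)` of all `A`-linear endomorphisms of `V` that commute with
`G`. -/
def EndRep (ρ : Representation A G V) : Type uV :=
  Subalgebra.centralizer A (Set.range ρ)

noncomputable instance (ρ : Representation A G V) : Ring (EndRep ρ) :=
  inferInstanceAs (Ring (Subalgebra.centralizer A (Set.range ρ)))

noncomputable instance (ρ : Representation A G V) : Algebra A (EndRep ρ) :=
  inferInstanceAs (Algebra A (Subalgebra.centralizer A (Set.range ρ)))

/-- The center of `End_{(A, G)}(V)`. -/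
def EndCenter (ρ : Representation A G V) : Type uV :=
  Subalgebra.center A (EndRep ρ)

noncomputable instance (ρ : Representation A G V) : CommRing (EndCenter ρ) :=
  inferInstanceAs (CommRing (Subalgebra.center A (EndRep ρ)))

noncomputable instance (ρ : Representation A G V) : Algebra A (EndCenter ρ) :=
  inferInstanceAs (Algebra A (Subalgebra.center A (EndRep ρ)))

/-- The inclusion of the center into `End_{(A, G)}(V)`. -/
noncomputable def EndCenter.incl (ρ : Representation A G V) : EndCenter ρ →ₐ[A] EndRep ρ :=
  (Subalgebra.center A (EndRep ρ)).val

/-- The inclusion of `End_{(A, G)}(V)` into the ring of all `A`-linear endomorphisms. -/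
noncomputable def EndRep.incl (ρ : Representation A G V) : EndRep ρ →ₐ[A] Module.End A V :=
  (Subalgebra.centralizer A (Set.range ρ)).val

/-- The center of `End_{(A, G)}(V)` acts on `V` by evaluation. -/
noncomputable instance (ρ : Representation A G V) : Module (EndCenter ρ) V :=
  Module.compHom V (((EndRep.incl ρ).comp (EndCenter.incl ρ) : EndCenter ρ →ₐ[A] Module.End A V) :
    EndCenter ρ →+* Module.End A V)

theorem EndCenter.smul_def (ρ : Representation A G V) (c : EndCenter ρ) (v : V) :
    c • v = EndRep.incl ρ (EndCenter.incl ρ c) v := rfl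

instance (ρ : Representation A G V) : IsScalarTower A (EndCenter ρ) V where
  smul_assoc a c v := by
    simp only [EndCenter.smul_def, map_smul, LinearMap.smul_apply]

/-- `V` with the given action of `G`, regarded as a representation over the center of
`End_{(A, G)}(V)`. -/
noncomputable def extRep (ρ : Representation A G V) : Representation (EndCenter ρ) G V where
  toFun g :=
    { toFun := fun v => ρ g v
      map_add' := fun v w => map_add (ρ g) v w
      map_smul' := fun c v => LinearMap.congr_fun
        (Subalgebra.mem_centralizer_iff A |>.1 (EndCenter.incl ρ c).2 (ρ g) ⟨g, rfl⟩) v }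
  map_one' := by ext v; simp
  map_mul' g h := by
    ext v
    change ρ (g * h) v = ρ g (ρ h v)
    rw [map_mul, Module.End.mul_apply]

@[simp] theorem extRep_apply (ρ : Representation A G V) (g : G) (v : V) :
    extRep ρ g v = ρ g v := rfl

/-- The base change `B ⊗ V` of `V`, regarded as a representation over the center `K` of
`End_{(A, G)}(V)`, to a `K`-algebra `B`; the tensor product is over `K`. -/
noncomputable def extBaseChange (ρ : Representation A G V) (B : Type uB) [CommRing B]
    [Algebra (EndCenter ρ) B] : Representation B G (B ⊗[EndCenter ρ] V) :=
  baseChangeRep B (extRep ρ)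

end Rep

section Hecke

variable {G : Type uG} [Group G]

/-- The sum over `x ∈ G / L` of a function that is right invariant under `L`. -/
noncomputable def cosetSum (L : Subgroup G) {M : Type*} [AddCommMonoid M] (φ : G → M) : M :=
  ∑ᶠ x : G ⧸ L, φ x.out

theorem apply_out_mk (L : Subgroup G) {M : Type*} {φ : G → M}
    (hφ : ∀ x, ∀ l ∈ L, φ (x * l) = φ x) (x : G) :
    φ (Quotient.out (QuotientGroup.mk x : G ⧸ L)) = φ x := by
  obtain ⟨l, hl⟩ := QuotientGroup.mk_out_eq_mul L x
  rw [hl, hφ x l l.2]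

theorem cosetSum_translate (L : Subgroup G) {M : Type*} [AddCommMonoid M] {φ : G → M}
    (hφ : ∀ x, ∀ l ∈ L, φ (x * l) = φ x) (g : G) :
    cosetSum L (fun x => φ (g * x)) = cosetSum L φ := by
  refine Eq.trans ?_ (finsum_comp_equiv (MulAction.toPerm g : Equiv.Perm (G ⧸ L)))
  refine finsum_congr fun x => ?_
  have h : (MulAction.toPerm g x : G ⧸ L) = QuotientGroup.mk (g * x.out) := by
    conv_lhs => rw [← QuotientGroup.out_eq' x]
    rfl
  rw [h]
  exact (apply_out_mk L hφ (g * x.out)).symm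

variable (B : Type uB) [CommRing B] (L : Subgroup G)

/-- The underlying space of the Hecke algebra `H(G, L, B)`: all functions `G → B` that are
`L`-biinvariant and supported on finitely many cosets of `L`. For open compact `L`, the last
condition says that the support is compact; see `isCompact_support_iff`. -/
def heckeSubmodule : Submodule B (G → B) where
  carrier := {f | (∀ l ∈ L, ∀ x, f (l * x) = f x) ∧ (∀ x, ∀ l ∈ L, f (x * l) = f x) ∧
    ((QuotientGroup.mk : G → G ⧸ L) '' Function.support f).Finite}
  zero_mem' := by simp
  add_mem' := by
    rintro f g ⟨hf1, hf2, hf3⟩ ⟨hg1, hg2, hg3⟩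
    refine ⟨fun l hl x => by simp [hf1 l hl, hg1 l hl], fun x l hl => by
      simp [hf2 x l hl, hg2 x l hl], (hf3.union hg3).subset ?_⟩
    rw [← Set.image_union]
    exact Set.image_mono (Function.support_add f g)
  smul_mem' := by
    rintro c f ⟨hf1, hf2, hf3⟩
    refine ⟨fun l hl x => by simp [hf1 l hl], fun x l hl => by simp [hf2 x l hl],
      hf3.subset (Set.image_mono ?_)⟩
    exact Function.support_const_smul_subset c f


/-- The Hecke algebra `H(G, L, B)`, with the convolution product with respect to the Haar measure
for which `L` has volume `1`. -/
def HeckeAlgebra : Type (max uG uB) := heckeSubmodule B L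

noncomputable instance : AddCommGroup (HeckeAlgebra B L) :=
  inferInstanceAs (AddCommGroup (heckeSubmodule B L))

noncomputable instance : Module B (HeckeAlgebra B L) :=
  inferInstanceAs (Module B (heckeSubmodule B L))

variable {B L}

instance : CoeFun (HeckeAlgebra B L) (fun _ => G → B) := ⟨fun f => f.1⟩

namespace HeckeAlgebra

theorem ext {f g : HeckeAlgebra B L} (h : ∀ x, f x = g x) : f = g := Subtype.ext (funext h)

theorem left_inv (f : HeckeAlgebra B L) {l : G} (hl : l ∈ L) (x : G) : f (l * x) = f x :=
  f.2.1 l hl x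

theorem right_inv (f : HeckeAlgebra B L) (x : G) {l : G} (hl : l ∈ L) : f (x * l) = f x :=
  f.2.2.1 x l hl

/-- The finite set of cosets on which `f` is supported. -/
noncomputable def cosets (f : HeckeAlgebra B L) : Finset (G ⧸ L) := f.2.2.2.toFinset

theorem mk_mem_cosets (f : HeckeAlgebra B L) {x : G} (hx : f x ≠ 0) :
    (QuotientGroup.mk x : G ⧸ L) ∈ f.cosets := by
  simpa [cosets] using ⟨x, hx, rfl⟩

theorem cosetSum_eq (f : HeckeAlgebra B L) {M : Type*} [AddCommMonoid M] {φ : G → M}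
    (h : ∀ x, f x = 0 → φ x = 0) {s : Finset (G ⧸ L)} (hs : f.cosets ⊆ s) :
    cosetSum L φ = ∑ q ∈ s, φ q.out := by
  refine finsum_eq_sum_of_support_subset _ fun q hq => hs ?_
  have h1 : f q.out ≠ 0 := fun h0 => hq (h _ h0)
  simpa using f.mk_mem_cosets h1

open Classical in
/-- A finite set of cosets that supports the convolution of `f` and `g`. -/
noncomputable def mulCosets (f g : HeckeAlgebra B L) : Finset (G ⧸ L) :=
  f.cosets.biUnion fun q => g.cosets.image fun r => q.out • r

theorem mk_mem_mulCosets (f g : HeckeAlgebra B L) {q : G ⧸ L} (hq : q ∈ f.cosets) {x : G}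
    (hx : g (q.out⁻¹ * x) ≠ 0) : (QuotientGroup.mk x : G ⧸ L) ∈ mulCosets f g := by
  classical
  simp only [mulCosets, Finset.mem_biUnion, Finset.mem_image]
  refine ⟨q, hq, _, g.mk_mem_cosets hx, ?_⟩
  change (QuotientGroup.mk (q.out * (q.out⁻¹ * x)) : G ⧸ L) = _
  rw [mul_inv_cancel_left]

/-- The convolution of two functions. -/
noncomputable def conv (f g : HeckeAlgebra B L) (x : G) : B :=
  cosetSum L fun y => f y * g (y⁻¹ * x)

theorem conv_eq (f g : HeckeAlgebra B L) (x : G) :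
    conv f g x = ∑ q ∈ f.cosets, f q.out * g (q.out⁻¹ * x) :=
  f.cosetSum_eq (fun y hy => by simp [hy]) subset_rfl

theorem conv_ne_zero (f g : HeckeAlgebra B L) {x : G} (hx : conv f g x ≠ 0) :
    (QuotientGroup.mk x : G ⧸ L) ∈ mulCosets f g := by
  rw [conv_eq] at hx
  obtain ⟨q, hq, h⟩ := Finset.exists_ne_zero_of_sum_ne_zero hx
  exact mk_mem_mulCosets f g hq (right_ne_zero_of_mul h)

/-- Multiplication in the Hecke algebra is convolution:
`(f * g)(x) = ∑ f(y) g(y⁻¹x)`, the sum being over `y ∈ G / L`. -/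
noncomputable instance : Mul (HeckeAlgebra B L) where
  mul f g := ⟨conv f g, by
    refine ⟨fun l hl x => ?_, fun x l hl => ?_, (mulCosets f g).finite_toSet.subset ?_⟩
    · have h := cosetSum_translate L (φ := fun y => f y * g (y⁻¹ * (l * x)))
        (fun y m hm => by
          have := g.left_inv (inv_mem hm) (y⁻¹ * (l * x))
          simp only [f.right_inv y hm, mul_inv_rev, mul_assoc, this]) l
      unfold conv
      rw [← h]
      congr 1
      funext y
      simp only [f.left_inv hl, mul_inv_rev, mul_assoc, inv_mul_cancel_left]
    · unfold conv
      congr 1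
      funext y
      rw [← mul_assoc, g.right_inv _ hl]
    · rintro _ ⟨x, hx, rfl⟩
      exact conv_ne_zero f g hx⟩

theorem mul_apply (f g : HeckeAlgebra B L) (x : G) :
    (f * g) x = cosetSum L fun y => f y * g (y⁻¹ * x) := rfl

/-- The unit element of the Hecke algebra is the characteristic function of `L`. -/
noncomputable instance : One (HeckeAlgebra B L) where
  one := ⟨Set.indicator (L : Set G) 1, by
    classical
    refine ⟨fun l hl x => ?_, fun x l hl => ?_,
      (Set.finite_singleton (QuotientGroup.mk 1 : G ⧸ L)).subset ?_⟩
    · simp [Set.indicator_apply, Subgroup.mul_mem_cancel_left L hl]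
    · simp [Set.indicator_apply, Subgroup.mul_mem_cancel_right L hl]
    · rintro _ ⟨x, hx, rfl⟩
      have hx : x ∈ L := Set.mem_of_indicator_ne_zero hx
      simpa [QuotientGroup.eq] using hx⟩

theorem one_apply (x : G) : (1 : HeckeAlgebra B L) x = Set.indicator (L : Set G) 1 x := rfl

@[simp] theorem add_apply (f g : HeckeAlgebra B L) (x : G) : (f + g) x = f x + g x := rfl

@[simp] theorem zero_apply (x : G) : (0 : HeckeAlgebra B L) x = 0 := rfl

@[simp] theorem smul_apply (c : B) (f : HeckeAlgebra B L) (x : G) : (c • f) x = c * f x := rfl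

section Action

variable {X : Type uX} [AddCommGroup X] [Module B X] (ρ : Representation B G X)

/-- The operator by which `f` acts: `f · v = ∑ f(x) ρ(x) v`, the sum being over `x ∈ G / L`. -/
noncomputable def act (f : HeckeAlgebra B L) (v : X) : X :=
  cosetSum L fun x => f x • ρ x v

theorem act_eq (f : HeckeAlgebra B L) (v : X) {s : Finset (G ⧸ L)} (hs : f.cosets ⊆ s) :
    act ρ f v = ∑ q ∈ s, f q.out • ρ q.out v :=
  f.cosetSum_eq (fun x hx => by simp [hx]) hs

theorem act_mul (f g : HeckeAlgebra B L) {v : X} (hv : ∀ l ∈ L, ρ l v = v) :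
    act ρ (f * g) v = act ρ f (act ρ g v) := by
  classical
  have key : ∀ q : G ⧸ L, f q.out • ρ q.out (act ρ g v) =
      cosetSum L fun y => (f q.out * g (q.out⁻¹ * y)) • ρ y v := by
    intro q
    rw [act_eq ρ g v subset_rfl]
    rw [← cosetSum_translate L _ q.out, g.cosetSum_eq _ subset_rfl]
    · simp only [map_sum, map_smul, Finset.smul_sum, inv_mul_cancel_left, map_mul,
        Module.End.mul_apply, mul_smul]
    · intro x hx
      simp [hx]
    · intro x l hl
      rw [← mul_assoc, g.right_inv _ hl, map_mul, Module.End.mul_apply, hv l hl]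
  have key2 : ∀ q ∈ f.cosets, (cosetSum L fun y => (f q.out * g (q.out⁻¹ * y)) • ρ y v) =
      ∑ r ∈ mulCosets f g, (f q.out * g (q.out⁻¹ * r.out)) • ρ r.out v := by
    intro q hq
    refine finsum_eq_sum_of_support_subset _ fun r hr => ?_
    have h1 : g (q.out⁻¹ * r.out) ≠ 0 := fun h0 => hr (by simp [h0])
    simpa using mk_mem_mulCosets f g hq h1
  have key3 : act ρ (f * g) v = ∑ r ∈ mulCosets f g, (f * g) r.out • ρ r.out v := by
    refine finsum_eq_sum_of_support_subset _ fun r hr => ?_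
    have h1 : (f * g) r.out ≠ 0 := fun h0 => hr (by simp [h0])
    simpa using conv_ne_zero f g h1
  rw [key3, act_eq ρ f (act ρ g v) subset_rfl, Finset.sum_congr rfl fun q _ => key q,
    Finset.sum_congr rfl key2, Finset.sum_comm]
  refine Finset.sum_congr rfl fun r _ => ?_
  rw [← Finset.sum_smul]
  congr 1
  exact conv_eq f g _

theorem act_one {v : X} (hv : ∀ l ∈ L, ρ l v = v) :
    act ρ (1 : HeckeAlgebra B L) v = v := by
  have h : ∀ q : G ⧸ L, q ≠ QuotientGroup.mk 1 →
      (1 : HeckeAlgebra B L) q.out • ρ q.out v = 0 := by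
    intro q hq
    rw [one_apply, Set.indicator_of_notMem, zero_smul]
    intro hL
    refine hq ?_
    rw [← QuotientGroup.out_eq' q, QuotientGroup.eq]
    simpa using hL
  unfold act cosetSum
  rw [finsum_eq_single _ _ h]
  obtain ⟨l, hl⟩ := QuotientGroup.mk_out_eq_mul L 1
  rw [hl, one_mul, hv l l.2, one_apply, Set.indicator_of_mem l.2]
  simp

theorem act_add (f : HeckeAlgebra B L) (v w : X) :
    act ρ f (v + w) = act ρ f v + act ρ f w := by
  simp only [act_eq ρ f _ subset_rfl, map_add, smul_add, Finset.sum_add_distrib]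

theorem act_zero (f : HeckeAlgebra B L) : act ρ f (0 : X) = 0 := by
  simp [act_eq ρ f _ subset_rfl]

theorem add_act (f g : HeckeAlgebra B L) (v : X) :
    act ρ (f + g) v = act ρ f v + act ρ g v := by
  classical
  have h : act ρ (f + g) v = ∑ q ∈ f.cosets ∪ g.cosets, (f + g) q.out • ρ q.out v := by
    refine finsum_eq_sum_of_support_subset _ fun q hq => ?_
    by_contra hn
    simp only [Finset.coe_union, Set.mem_union, Finset.mem_coe, not_or] at hn
    have h1 : f q.out = 0 := by
      by_contra h1; exact hn.1 (by simpa using f.mk_mem_cosets h1)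
    have h2 : g q.out = 0 := by
      by_contra h2; exact hn.2 (by simpa using g.mk_mem_cosets h2)
    exact hq (by simp [h1, h2])
  rw [h, act_eq ρ f v Finset.subset_union_left, act_eq ρ g v Finset.subset_union_right,
    ← Finset.sum_add_distrib]
  simp only [add_apply, add_smul]

theorem zero_act (v : X) : act ρ (0 : HeckeAlgebra B L) v = 0 := by
  simp [act, cosetSum]

theorem smul_act (c : B) (f : HeckeAlgebra B L) (v : X) :
    act ρ (c • f) v = c • act ρ f v := by
  rw [act_eq ρ f v subset_rfl, Finset.smul_sum]
  simp only [act, smul_apply, mul_smul]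
  exact f.cosetSum_eq (fun x hx => by simp [hx]) subset_rfl

theorem map_act (f : HeckeAlgebra B L) {v : X} (hv : ∀ l ∈ L, ρ l v = v) (l : G) (hl : l ∈ L) :
    ρ l (act ρ f v) = act ρ f v := by
  have h := cosetSum_translate L (φ := fun x => f x • ρ x v)
    (fun x m hm => by rw [f.right_inv x hm, map_mul, Module.End.mul_apply, hv m hm]) l
  have h2 : cosetSum L (fun x => f (l * x) • ρ (l * x) v) =
      ∑ q ∈ f.cosets, f (l * q.out) • ρ (l * q.out) v :=
    f.cosetSum_eq (fun x hx => by simp [f.left_inv hl, hx]) subset_rfl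
  rw [act_eq ρ f v subset_rfl, ← act_eq ρ f v subset_rfl]
  refine Eq.trans ?_ h
  rw [h2, act_eq ρ f v subset_rfl]
  simp only [map_sum, map_smul, f.left_inv hl, map_mul, Module.End.mul_apply]

end Action

/-- The left regular representation of `G` on functions. -/
def leftRegular : Representation B G (G → B) where
  toFun g :=
    { toFun := fun φ x => φ (g⁻¹ * x)
      map_add' := fun _ _ => rfl
      map_smul' := fun _ _ => rfl }
  map_one' := by ext φ x; simp
  map_mul' g h := by ext φ x; simp [mul_assoc]

theorem coe_mul_eq_act (f g : HeckeAlgebra B L) :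
    ((f * g : HeckeAlgebra B L) : G → B) = act leftRegular f (g : G → B) := by
  funext x
  rw [act_eq _ f _ subset_rfl, Finset.sum_apply]
  exact conv_eq f g x

theorem leftRegular_fixed (g : HeckeAlgebra B L) :
    ∀ l ∈ L, leftRegular l (g : G → B) = (g : G → B) := by
  intro l hl
  funext x
  exact g.left_inv (inv_mem hl) x

noncomputable instance : Ring (HeckeAlgebra B L) :=
  { (inferInstance : AddCommGroup (HeckeAlgebra B L)),
    (inferInstance : Mul (HeckeAlgebra B L)), (inferInstance : One (HeckeAlgebra B L)) with
    left_distrib := fun f g h => Subtype.ext <| by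
      change ((f * (g + h) : HeckeAlgebra B L) : G → B) = (f * g : HeckeAlgebra B L).1 + (f * h).1
      rw [coe_mul_eq_act, coe_mul_eq_act, coe_mul_eq_act, ← act_add]
      rfl
    right_distrib := fun f g h => Subtype.ext <| by
      change (((f + g) * h : HeckeAlgebra B L) : G → B) = (f * h : HeckeAlgebra B L).1 + (g * h).1
      rw [coe_mul_eq_act, coe_mul_eq_act, coe_mul_eq_act, ← add_act]
    zero_mul := fun f => Subtype.ext <| by
      rw [coe_mul_eq_act, zero_act]; rfl
    mul_zero := fun f => Subtype.ext <| by
      rw [coe_mul_eq_act]; exact act_zero _ f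
    mul_assoc := fun f g h => Subtype.ext <| by
      rw [coe_mul_eq_act, act_mul _ _ _ (leftRegular_fixed h), coe_mul_eq_act, coe_mul_eq_act]
    one_mul := fun f => Subtype.ext <| by
      rw [coe_mul_eq_act, act_one _ (leftRegular_fixed f)]
    mul_one := fun f => ext fun x => by
      have h : ∀ q : G ⧸ L, q ≠ QuotientGroup.mk x →
          f q.out * (1 : HeckeAlgebra B L) (q.out⁻¹ * x) = 0 := by
        intro q hq
        rw [one_apply, Set.indicator_of_notMem, mul_zero]
        intro hL
        exact hq (by rw [← QuotientGroup.out_eq' q]; exact QuotientGroup.eq.2 hL)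
      change cosetSum L (fun y => f y * (1 : HeckeAlgebra B L) (y⁻¹ * x)) = f x
      unfold cosetSum
      rw [finsum_eq_single _ _ h]
      obtain ⟨l, hl⟩ := QuotientGroup.mk_out_eq_mul L x
      have hm : (x * (l : G))⁻¹ * x ∈ (L : Set G) := by simp
      rw [hl, f.right_inv x l.2, one_apply, Set.indicator_of_mem hm]
      simp }

/-- The Hecke algebra acts on the space of `L`-fixed vectors of a representation. -/
noncomputable instance instModuleFixedVectors {X : Type uX} [AddCommGroup X] [Module B X]
    (ρ : Representation B G X) : Module (HeckeAlgebra B L) (fixedVectors ρ L) where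
  smul f v := ⟨act ρ f v, fun l => map_act ρ f (fun m hm => v.2 ⟨m, hm⟩) l l.2⟩
  one_smul v := Subtype.ext (act_one ρ fun m hm => v.2 ⟨m, hm⟩)
  mul_smul f g v := Subtype.ext (act_mul ρ f g fun m hm => v.2 ⟨m, hm⟩)
  smul_zero f := Subtype.ext (act_zero ρ f)
  smul_add f v w := Subtype.ext (act_add ρ f v w)
  add_smul f g v := Subtype.ext (add_act ρ f g v)
  zero_smul v := Subtype.ext (zero_act ρ v)

instance {X : Type uX} [AddCommGroup X] [Module B X] (ρ : Representation B G X) :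
    IsScalarTower B (HeckeAlgebra B L) (fixedVectors ρ L) where
  smul_assoc c f v := Subtype.ext (smul_act ρ c f v)

/-- For open compact `L`, a function that is right invariant under `L` is supported on finitely
many cosets of `L` if and only if its support is compact. -/
theorem isCompact_support_iff [TopologicalSpace G] [IsTopologicalGroup G] {L : Subgroup G}
    (hLo : IsOpen (L : Set G)) (hLc : IsCompact (L : Set G)) {f : G → B}
    (hf : ∀ x, ∀ l ∈ L, f (x * l) = f x) :
    IsCompact (Function.support f) ↔
      ((QuotientGroup.mk : G → G ⧸ L) '' Function.support f).Finite := by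
  constructor
  · intro h
    have hd : DiscreteTopology (G ⧸ L) := QuotientGroup.discreteTopology hLo
    exact (h.image (QuotientGroup.continuous_mk (N := L))).finite_of_discrete
  · intro h
    have h1 : Function.support f =
        ⋃ q ∈ (QuotientGroup.mk : G → G ⧸ L) '' Function.support f,
          (fun x => q.out * x) '' (L : Set G) := by
      ext x
      simp only [Set.mem_iUnion, Set.mem_image, exists_prop]
      constructor
      · intro hx
        obtain ⟨l, hl⟩ := QuotientGroup.mk_out_eq_mul L x
        exact ⟨_, ⟨x, hx, rfl⟩, (l : G)⁻¹, inv_mem l.2, by rw [hl]; simp⟩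
      · rintro ⟨_, ⟨y, hy, rfl⟩, l, hl, rfl⟩
        obtain ⟨m, hm⟩ := QuotientGroup.mk_out_eq_mul L y
        rw [Function.mem_support, hf _ l hl, hm, hf _ m m.2]
        exact hy
    rw [h1]
    exact h.isCompact_biUnion fun q _ => hLc.image (continuous_const_mul q.out)

end HeckeAlgebra

end Hecke

/-! Write `K` for the center of `D = End(V)`. By Schur, `D` is a division ring, and evaluation at a
nonzero vector of `V^L` embeds it into `V^L`, so `D` is finite-dimensional over `A`.

The core is a density argument, `Submodule.eq_bot_or_eq_top_of_baseChange_mem`: if a set of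
operators acts irreducibly on `V` and commutes only with the scalars `K`, then its action on `B ⊗ V`
is still irreducible. The operators from `G` and `D` together satisfy this, because an operator
commuting with `G` lies in `D`, and one commuting with `D` as well lies in `K`. So `B ⊗ V` has no
proper nonzero subspace stable under both. Let `W` be a maximal `G`-stable proper subspace. The
vectors that all of `D` sends into `W` form such a subspace, hence vanish; as `D` is spanned by
finitely many elements, `B ⊗ V` embeds into a finite power of its irreducible quotient by `W`. It is
therefore a finite sum of copies of that quotient, which is `V(B)`. Uniqueness is Schur's lemma.

Simplicity of `V(B)^L` comes from averaging over `L`, where characteristic 0 enters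
(`isSimpleModule_fixedVectors`). If `B` is a maximal subfield of `D`, then `V` itself is a
`B`-representation and a quotient of `B ⊗ V`, hence isomorphic to `V(B)`. Its commutant is the
centralizer of `B` in `D`, which is `B` by maximality, and the density argument now gives absolute
irreducibility. -/

/-! ### Stable subspaces of a base change -/

section BaseChange

variable {K B V : Type*} [CommRing K] [Field B] [Algebra K B] [AddCommGroup V] [Module K V]

/-- The vectors `w` with `1 ⊗ w ∈ N` form a nonzero `T`-stable subspace of `V`, hence all of `V`,
and the `1 ⊗ w` span `B ⊗ V` over `B`. -/
theorem Submodule.eq_top_of_one_tmul_mem (T : Set (Module.End K V))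
    (hsimple : ∀ W : Submodule K V, (∀ t ∈ T, ∀ v ∈ W, t v ∈ W) → W = ⊥ ∨ W = ⊤)
    (N : Submodule B (B ⊗[K] V)) (hN : ∀ t ∈ T, ∀ x ∈ N, t.baseChange B x ∈ N)
    {v : V} (hv : v ≠ 0) (hvN : 1 ⊗ₜ[K] v ∈ N) : N = ⊤ := by
  have hW : (N.restrictScalars K).comap (TensorProduct.mk K B V 1) = ⊤ := by
    refine (hsimple _ fun t ht w hw => ?_).resolve_left fun h => hv ?_
    · have := hN t ht _ hw
      simpa using this
    · have : v ∈ (N.restrictScalars K).comap (TensorProduct.mk K B V 1) := hvN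
      rwa [h, Submodule.mem_bot] at this
  refine eq_top_iff.2 fun x _ => ?_
  induction x with
  | zero => exact zero_mem _
  | add x y hx hy => exact add_mem (hx trivial) (hy trivial)
  | tmul b w =>
    have hw : w ∈ (N.restrictScalars K).comap (TensorProduct.mk K B V 1) := hW ▸ trivial
    have := N.smul_mem b (show (1 : B) ⊗ₜ[K] w ∈ N from hw)
    simpa [TensorProduct.smul_tmul'] using this

theorem equivFinsuppOfBasisLeft_baseChange {ι : Type*} [DecidableEq ι] (b : Module.Basis ι K B)
    (t : Module.End K V) (x : B ⊗[K] V) (i : ι) :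
    TensorProduct.equivFinsuppOfBasisLeft b (t.baseChange B x) i =
      t (TensorProduct.equivFinsuppOfBasisLeft b x i) := by
  induction x with
  | zero => simp
  | add x y hx hy => simp [hx, hy]
  | tmul c w => simp

/-- A shortest-vector argument. Expand the elements of `N` along a `K`-basis of `B`, with
coordinates in `V`. In a nonzero element with fewest coordinates, all coordinates are `K`-multiples
of a single one, so the element is a pure tensor and can be scaled to the form `1 ⊗ v`. -/
theorem Submodule.eq_bot_or_eq_top_of_baseChange_mem [Module.Free K B] (T : Set (Module.End K V))
    (hsimple : ∀ W : Submodule K V, (∀ t ∈ T, ∀ v ∈ W, t v ∈ W) → W = ⊥ ∨ W = ⊤)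
    (hcomm : ∀ φ : Module.End K V, (∀ t ∈ T, ∀ v, φ (t v) = t (φ v)) → ∃ c : K, ∀ v, φ v = c • v)
    (N : Submodule B (B ⊗[K] V)) (hN : ∀ t ∈ T, ∀ x ∈ N, t.baseChange B x ∈ N) :
    N = ⊥ ∨ N = ⊤ := by
  classical
  refine or_iff_not_imp_left.2 fun hbot => ?_
  let b := Module.Free.chooseBasis K B
  let e := TensorProduct.equivFinsuppOfBasisLeft (N := V) b
  have he : ∀ (t : Module.End K V) x i, e (t.baseChange B x) i = t (e x i) :=
    equivFinsuppOfBasisLeft_baseChange b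
  obtain ⟨y, hyN, hy0⟩ := Submodule.exists_mem_ne_zero_of_ne_bot hbot
  obtain ⟨n, ⟨hnN, hn0⟩, hmin⟩ := (measure fun x : B ⊗[K] V => (e x).support.card).wf.has_min
    {x | x ∈ N ∧ x ≠ 0} ⟨y, hyN, hy0⟩
  have hen : e n ≠ 0 := fun h => hn0 (e.map_eq_zero_iff.1 h)
  obtain ⟨i₀, hi₀⟩ := Finsupp.ne_iff.1 hen
  simp only [Finsupp.coe_zero, Pi.zero_apply] at hi₀
  let S := Algebra.adjoin K T
  have hS : ∀ a ∈ S, ∀ x ∈ N, a.baseChange B x ∈ N := by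
    intro a ha
    induction ha using Algebra.adjoin_induction with
    | mem t ht => exact hN t ht
    | algebraMap r =>
      intro x hx
      rw [Algebra.algebraMap_eq_smul_one, LinearMap.baseChange_smul, LinearMap.smul_apply,
        Module.End.one_eq_id, LinearMap.baseChange_id, LinearMap.id_apply]
      exact N.smul_of_tower_mem r hx
    | add a a' _ _ h h' =>
      intro x hx
      rw [LinearMap.baseChange_add]
      exact add_mem (h x hx) (h' x hx)
    | mul a a' _ _ h h' =>
      intro x hx
      rw [LinearMap.baseChange_mul]
      exact h _ (h' x hx)
  -- Applying `a` creates no new coordinate; if it kills the one at `i₀`, minimality forces it to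
  -- kill `n`.
  have hker : ∀ a ∈ S, a (e n i₀) = 0 → ∀ i, a (e n i) = 0 := by
    intro a ha h0 i
    rw [← he]
    suffices h : a.baseChange B n = 0 by simp [h]
    by_contra h
    refine hmin _ ⟨hS a ha n hnN, h⟩ (Finset.card_lt_card ?_)
    refine (Finset.ssubset_iff_of_subset fun j hj => ?_).2 ⟨i₀, by simpa using hi₀, by simp [he, h0]⟩
    rw [Finsupp.mem_support_iff, he] at hj
    exact Finsupp.mem_support_iff.2 fun h => hj (by rw [h, map_zero])
  let f (i) : S →ₗ[K] V :=
    { toFun := fun a => (a : Module.End K V) (e n i)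
      map_add' := fun _ _ => rfl
      map_smul' := fun _ _ => rfl }
  have hf : Function.Surjective (f i₀) := by
    refine LinearMap.range_eq_top.1 ((hsimple _ ?_).resolve_left fun h => hi₀ ?_)
    · rintro t ht _ ⟨a, rfl⟩
      exact ⟨⟨t, Algebra.subset_adjoin ht⟩ * a, rfl⟩
    · have : f i₀ 1 ∈ LinearMap.range (f i₀) := ⟨1, rfl⟩
      rwa [h, Submodule.mem_bot] at this
  -- By `hker` the assignment `a (e n i₀) ↦ a (e n i)` is well defined on `V`. It commutes with `T`,
  -- so it is a scalar.
  have hc : ∀ i, ∃ c : K, e n i = c • e n i₀ := by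
    intro i
    let φ : V →ₗ[K] V := ((LinearMap.ker (f i₀)).liftQ (f i) fun a ha => hker a a.2 ha i).comp
      ((f i₀).quotKerEquivOfSurjective hf).symm.toLinearMap
    have hφ : ∀ a, φ (f i₀ a) = f i a := by
      intro a
      have : ((f i₀).quotKerEquivOfSurjective hf).symm (f i₀ a) = Submodule.Quotient.mk a := by
        rw [LinearEquiv.symm_apply_eq]; rfl
      simp only [φ, LinearMap.comp_apply, LinearEquiv.coe_coe, this]
      exact Submodule.liftQ_apply _ _ _
    obtain ⟨c, hc⟩ := hcomm φ fun t ht v => by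
      obtain ⟨a, rfl⟩ := hf v
      have h1 := hφ (⟨t, Algebra.subset_adjoin ht⟩ * a)
      rw [hφ]
      exact h1
    exact ⟨c, (hφ 1).symm.trans (hc _)⟩
  choose c hc using hc
  have hn : n = (∑ i ∈ (e n).support, c i • b i) ⊗ₜ[K] e n i₀ := by
    conv_lhs => rw [← e.symm_apply_apply n, TensorProduct.equivFinsuppOfBasisLeft_symm_apply]
    rw [Finsupp.sum, TensorProduct.sum_tmul]
    refine Finset.sum_congr rfl fun i _ => ?_
    conv_lhs => rw [hc i, TensorProduct.tmul_smul, TensorProduct.smul_tmul']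
  set β := ∑ i ∈ (e n).support, c i • b i
  have hβ : β ≠ 0 := fun h => hn0 (by rw [hn, h, TensorProduct.zero_tmul])
  refine N.eq_top_of_one_tmul_mem T hsimple hN hi₀ ?_
  have := N.smul_mem β⁻¹ hnN
  rwa [hn, TensorProduct.smul_tmul', smul_eq_mul, inv_mul_cancel₀ hβ] at this

end BaseChange

/-! ### Splitting into copies of one simple quotient -/

/-- For a maximal submodule `N`, the maps `φ i` followed by the projection to `M ⧸ N` embed `M` into
a finite power of this simple module. Hence `M` is semisimple and isotypic, and finite generation
bounds the number of copies. -/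
theorem Submodule.exists_isCoatom_linearEquiv_fun_quotient {R M ι : Type*} [Ring R]
    [AddCommGroup M] [Module R M] [Nontrivial M] [Module.Finite R M] [Finite ι]
    (φ : ι → Module.End R M)
    (hφ : ∀ N : Submodule R M, N ≠ ⊤ → ∀ x, (∀ i, φ i x ∈ N) → x = 0) :
    ∃ N : Submodule R M, IsCoatom N ∧ ∃ n : ℕ, Nonempty (M ≃ₗ[R] (Fin n → M ⧸ N)) := by
  obtain ⟨N, hN, -⟩ := (eq_top_or_exists_le_coatom (⊥ : Submodule R M)).resolve_left bot_ne_top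
  have : IsSimpleModule R (M ⧸ N) := isSimpleModule_iff_isCoatom.2 hN
  let f : M →ₗ[R] (ι → M ⧸ N) := LinearMap.pi fun i => N.mkQ.comp (φ i)
  have hf : Function.Injective f := by
    refine (injective_iff_map_eq_zero f).2 fun x hx => hφ N hN.1 x fun i => ?_
    exact (Submodule.Quotient.mk_eq_zero N).1 (congrFun hx i)
  have hs : IsSemisimpleModule R M := IsSemisimpleModule.of_injective f hf
  have ht : IsIsotypicOfType R (ι → M ⧸ N) (M ⧸ N) := by
    intro m hm
    have : Nontrivial m := IsSimpleModule.nontrivial R m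
    obtain ⟨y, hy⟩ := exists_ne (0 : m)
    obtain ⟨i, hi⟩ := Function.ne_iff.1 (fun h => hy (Subtype.ext h) : (y : ι → M ⧸ N) ≠ 0)
    let p : m →ₗ[R] M ⧸ N := (LinearMap.proj i).comp m.subtype
    exact ⟨LinearEquiv.ofBijective p ((LinearMap.bijective_or_eq_zero p).resolve_right
      fun h => hi (LinearMap.congr_fun h y))⟩
  exact ⟨N, hN, (ht.of_injective f hf).linearEquiv_fun⟩

namespace Representation

open scoped MonoidAlgebra

variable {G : Type*} [Group G] {k : Type*} [Field k]
variable {X : Type*} [AddCommGroup X] [Module k X]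

theorem isIrreducible_iff_forall_submodule (ρ : Representation k G X) :
    ρ.IsIrreducible ↔ Nontrivial X ∧
      ∀ W : Submodule k X, (∀ g, ∀ v ∈ W, ρ g v ∈ W) → W = ⊥ ∨ W = ⊤ := by
  constructor
  · intro h
    refine ⟨?_, fun W hW => ?_⟩
    · by_contra hn
      rw [not_nontrivial_iff_subsingleton] at hn
      refine bot_ne_top (α := Subrepresentation ρ) ?_
      exact Subrepresentation.toSubmodule_injective (Subsingleton.elim _ _)
    · exact (eq_bot_or_eq_top (⟨W, fun g v => hW g v⟩ : Subrepresentation ρ)).imp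
        (congrArg Subrepresentation.toSubmodule) (congrArg Subrepresentation.toSubmodule)
  · rintro ⟨hn, h⟩
    refine { exists_pair_ne := ⟨⊥, ⊤, fun h => bot_ne_top (α := Submodule k X)
      (congrArg Subrepresentation.toSubmodule h)⟩, eq_bot_or_eq_top := fun W => ?_ }
    exact (h W.toSubmodule fun g v hv => W.apply_mem_toSubmodule g hv).imp
      (fun h => Subrepresentation.toSubmodule_injective h)
      (fun h => Subrepresentation.toSubmodule_injective h)

/-- The module-theoretic splitting read over `k[G]`: `v₀` is a cyclic generator and the `φ i` are
`k[G]`-endomorphisms. The surjection is kept because smoothness descends along it. -/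
theorem exists_isIrreducible_isSumOfCopies {X : Type uX} [AddCommGroup X] [Module k X]
    (ρ : Representation k G X) [Nontrivial X]
    {v₀ : X} (hv₀ : ∀ W : Submodule k X, (∀ g, ∀ v ∈ W, ρ g v ∈ W) → v₀ ∈ W → W = ⊤)
    {ι : Type*} [Finite ι] (φ : ι → Module.End k X) (hcomm : ∀ i g v, φ i (ρ g v) = ρ g (φ i v))
    (hφ : ∀ W : Submodule k X, (∀ g, ∀ v ∈ W, ρ g v ∈ W) → W ≠ ⊤ →
      ∀ x, (∀ i, φ i x ∈ W) → x = 0) :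
    ∃ (Y : Type uX) (_ : AddCommGroup Y) (_ : Module k Y) (σ : Representation k G Y),
      σ.IsIrreducible ∧ (∃ π : IntertwiningMap ρ σ, Function.Surjective π) ∧
        ∃ n : ℕ, IsSumOfCopies ρ σ n := by
  let M := ρ.asModule
  let q : X ≃ₗ[k] M := ρ.asModuleEquiv.symm
  have hq : ∀ g x, q (ρ g x) = MonoidAlgebra.single g (1 : k) • q x :=
    fun g x => ρ.asModuleEquiv_symm_map_rho g x
  have hMn : Nontrivial M := inferInstanceAs (Nontrivial X)
  let S (N : Submodule k[G] M) : Submodule k X := (N.restrictScalars k).comap q.toLinearMap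
  have hstab : ∀ N : Submodule k[G] M, ∀ g, ∀ v ∈ S N, ρ g v ∈ S N := by
    intro N g v hv
    change q (ρ g v) ∈ N
    rw [hq]
    exact N.smul_mem _ hv
  have htop : ∀ N : Submodule k[G] M, S N = ⊤ → N = ⊤ := fun N h => eq_top_iff.2 fun x _ => by
    have : q.symm x ∈ S N := h ▸ Submodule.mem_top
    simpa [S] using this
  have hMf : Module.Finite k[G] M := by
    refine ⟨⟨{q v₀}, htop _ (hv₀ _ (hstab _) ?_)⟩⟩
    have : q v₀ ∈ Submodule.span k[G] (({q v₀} : Finset M) : Set M) :=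
      Submodule.subset_span (by simp)
    exact this
  let ψ (i : ι) : Module.End k[G] M := IntertwiningMap.equivLinearMapAsModule ρ ρ
    ⟨φ i, fun g => LinearMap.ext (hcomm i g)⟩
  obtain ⟨N, hN, n, ⟨e⟩⟩ := Submodule.exists_isCoatom_linearEquiv_fun_quotient ψ
    fun N hN x hx => hφ (S N) (hstab N) (fun h => hN (htop N h)) x hx
  have hsimple : IsSimpleModule k[G] (M ⧸ N) := isSimpleModule_iff_isCoatom.2 hN
  let σ : Representation k G (M ⧸ N) := ofModule' (M ⧸ N)
  have hσ : ∀ g (y : M ⧸ N), σ g y = MonoidAlgebra.single g (1 : k) • y := by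
    intro g y
    simp only [σ, ofModule', MonoidAlgebra.lift_symm_apply]
    rfl
  refine ⟨M ⧸ N, inferInstance, inferInstance, σ, ?_, ?_, n, ⟨?_⟩⟩
  · refine σ.isIrreducible_iff_forall_submodule.2 ⟨IsSimpleModule.nontrivial k[G] _, fun U hU => ?_⟩
    let U' : Submodule k[G] (M ⧸ N) :=
      { U with
        smul_mem' := fun c y hy => by
          change c • y ∈ U
          induction c using MonoidAlgebra.induction_on with
          | of g => rw [MonoidAlgebra.of_apply, ← hσ]; exact hU g y hy
          | add a b ha hb => rw [add_smul]; exact add_mem ha hb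
          | smul r a ha => rw [smul_assoc]; exact U.smul_mem r ha }
    refine (eq_bot_or_eq_top U').imp (fun h => ?_) (fun h => ?_)
    · ext y
      have : y ∈ U' ↔ y ∈ (⊥ : Submodule k[G] (M ⧸ N)) := by rw [h]
      simpa [U'] using this
    · ext y
      have : y ∈ U' ↔ y ∈ (⊤ : Submodule k[G] (M ⧸ N)) := by rw [h]
      simpa [U'] using this
  · refine ⟨⟨(N.mkQ.restrictScalars k).comp q.toLinearMap, fun g => LinearMap.ext fun x => ?_⟩,
      N.mkQ_surjective.comp q.surjective⟩
    simp only [LinearMap.comp_apply, LinearEquiv.coe_coe, hq, hσ, LinearMap.restrictScalars_apply,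
      map_smul]
  · refine Equiv.mk ((q.trans (e.restrictScalars k)).trans
      (DirectSum.linearEquivFunOnFintype k (Fin n) fun _ => M ⧸ N).symm) fun g => ?_
    refine LinearMap.ext fun x => ?_
    apply (DirectSum.linearEquivFunOnFintype k (Fin n) fun _ => M ⧸ N).injective
    funext j
    have h1 : ∀ z, DirectSum.linearEquivFunOnFintype k (Fin n) (fun _ => M ⧸ N)
        ((directSum fun _ : Fin n => σ) g z) j =
          σ g (DirectSum.linearEquivFunOnFintype k (Fin n) (fun _ => M ⧸ N) z j) := fun z => rfl
    simp only [LinearMap.comp_apply, LinearEquiv.coe_coe, LinearEquiv.trans_apply,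
      LinearEquiv.apply_symm_apply, hq, LinearEquiv.restrictScalars_apply, map_smul, h1, hσ,
      Pi.smul_apply]

end Representation

/-! ### Smoothness under quotients and base change -/

section Smooth

variable {G : Type*} [Group G] [TopologicalSpace G] [IsTopologicalGroup G]

/-- The stabilizer is a subgroup, so it is open as soon as it contains a neighbourhood of `1`. -/
theorem Representation.isOpen_setOf_apply_eq {k X : Type*} [CommSemiring k] [AddCommMonoid X]
    [Module k X] (ρ : Representation k G X) {v : X} {U : Set G} (hU : U ∈ nhds (1 : G))
    (h : ∀ g ∈ U, ρ g v = v) : IsOpen {g : G | ρ g v = v} := by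
  let H : Subgroup G :=
    { carrier := {g | ρ g v = v}
      mul_mem' := fun {a b} ha hb => by
        simp only [Set.mem_ofPred_eq] at ha hb ⊢
        rw [map_mul, Module.End.mul_apply, hb, ha]
      one_mem' := by simp
      inv_mem' := fun {a} ha => by
        simp only [Set.mem_ofPred_eq] at ha ⊢
        rw [ρ.inv_apply_eq_iff, ha] }
  exact H.isOpen_of_mem_nhds (g := 1) (Filter.mem_of_superset hU h)

omit [IsTopologicalGroup G] in
theorem IsSmoothRep.setOf_mem_nhds_one {k X : Type*} [CommSemiring k] [AddCommMonoid X]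
    [Module k X] {ρ : Representation k G X} (h : IsSmoothRep ρ) (v : X) :
    {g : G | ρ g v = v} ∈ nhds (1 : G) :=
  (h v).mem_nhds (by simp)

theorem IsSmoothRep.of_surjective {k X Y : Type*} [CommSemiring k] [AddCommMonoid X] [Module k X]
    [AddCommMonoid Y] [Module k Y] {ρ : Representation k G X} {σ : Representation k G Y}
    (h : IsSmoothRep ρ) (π : ρ.IntertwiningMap σ) (hπ : Function.Surjective π) :
    IsSmoothRep σ := by
  intro y
  obtain ⟨x, rfl⟩ := hπ y
  refine σ.isOpen_setOf_apply_eq (h.setOf_mem_nhds_one x) fun g (hg : ρ g x = x) => ?_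
  rw [← π.isIntertwining, hg]

theorem IsSmoothRep.baseChangeRep {k X : Type*} [CommRing k] [AddCommGroup X] [Module k X]
    {ρ : Representation k G X} (h : IsSmoothRep ρ) (B : Type*) [CommRing B] [Algebra k B] :
    IsSmoothRep (baseChangeRep B ρ) := by
  intro x
  induction x with
  | zero => simp
  | add x y hx hy =>
    refine Representation.isOpen_setOf_apply_eq _
      ((hx.inter hy).mem_nhds (by simp)) fun g hg => ?_
    rw [map_add, hg.1, hg.2]
  | tmul b v =>
    refine Representation.isOpen_setOf_apply_eq _ (h.setOf_mem_nhds_one v)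
      fun g (hg : ρ g v = v) => ?_
    change b ⊗ₜ[k] ρ g v = _
    rw [hg]

end Smooth

/-! ### Maps into and out of a sum of copies -/

section SumOfCopies

open Representation

variable {G : Type*} [Group G]

namespace IsSumOfCopies

variable {k X Y : Type*} [CommRing k] [AddCommGroup X] [Module k X] [AddCommGroup Y] [Module k Y]
  {ρ : Representation k G X} {σ : Representation k G Y} {n : ℕ}

theorem exists_apply_ne_zero (h : IsSumOfCopies ρ σ n) {x : X} (hx : x ≠ 0) :
    ∃ p : ρ.IntertwiningMap σ, p x ≠ 0 := by
  obtain ⟨e⟩ := h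
  have hex : e x ≠ 0 := fun h0 => hx (e.toLinearEquiv.map_eq_zero_iff.1 h0)
  obtain ⟨i, hi⟩ := DFinsupp.ne_iff.1 hex
  refine ⟨⟨(DirectSum.component k (Fin n) (fun _ => Y) i).comp e.toLinearMap,
    fun g => LinearMap.ext fun v => ?_⟩, hi⟩
  have := IntertwiningMap.isIntertwining _ _ e.toIntertwiningMap g v
  change DirectSum.component k (Fin n) (fun _ => Y) i (e (ρ g v)) = _
  rw [← Equiv.coe_toIntertwiningMap, this]
  rfl

/-- Nontriviality of `X` rules out `n = 0`, so there is a summand to include. -/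
theorem exists_injective [Nontrivial X] (h : IsSumOfCopies ρ σ n) :
    ∃ f : σ.IntertwiningMap ρ, Function.Injective f := by
  obtain ⟨e⟩ := h
  obtain ⟨x, hx⟩ := exists_ne (0 : X)
  have hex : e x ≠ 0 := fun h0 => hx (e.toLinearEquiv.map_eq_zero_iff.1 h0)
  obtain ⟨i, hi⟩ := DFinsupp.ne_iff.1 hex
  let inc : σ.IntertwiningMap (directSum fun _ : Fin n => σ) :=
    ⟨DirectSum.lof k (Fin n) (fun _ => Y) i, fun g => LinearMap.ext fun v => by
      simp [DirectSum.lmap_lof]⟩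
  exact ⟨e.symm.toIntertwiningMap.comp inc, e.symm.toLinearEquiv.injective.comp
    (DirectSum.of_injective i)⟩

end IsSumOfCopies

/-- A nonzero map out of the sum is nonzero on some summand, where Schur's lemma makes it an
isomorphism. Uniqueness of `V(B)` and its identification with `V` over a maximal subfield both rest
on this. -/
theorem IsSumOfCopies.nonempty_equiv {k X Y Z : Type*} [Field k] [AddCommGroup X] [Module k X]
    [AddCommGroup Y] [Module k Y] [AddCommGroup Z] [Module k Z] {ρ : Representation k G X}
    {σ : Representation k G Y} {τ : Representation k G Z} {n : ℕ} (h : IsSumOfCopies ρ σ n)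
    [σ.IsIrreducible] [τ.IsIrreducible] (ψ : ρ.IntertwiningMap τ) (hψ : ψ ≠ 0) :
    Nonempty (σ.Equiv τ) := by
  obtain ⟨e⟩ := h
  let inc (i : Fin n) : σ.IntertwiningMap (directSum fun _ : Fin n => σ) :=
    ⟨DirectSum.lof k (Fin n) (fun _ => Y) i, fun g => LinearMap.ext fun v => by
      simp [DirectSum.lmap_lof]⟩
  by_contra hne
  have h0 : ∀ i, (ψ.comp e.symm.toIntertwiningMap).comp (inc i) = 0 := fun i =>
    (IsIrreducible.bijective_or_eq_zero _).resolve_left fun hb => hne ⟨IntertwiningMap.ofBijective _ hb⟩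
  have h1 : (ψ.comp e.symm.toIntertwiningMap).toLinearMap = 0 :=
    DirectSum.linearMap_ext k fun i => congrArg IntertwiningMap.toLinearMap (h0 i)
  refine hψ (IntertwiningMap.ext (LinearMap.ext fun x => ?_))
  have := LinearMap.congr_fun h1 (e x)
  change ψ (e.symm (e x)) = 0 at this
  rwa [show e.symm (e x) = x from e.toLinearEquiv.symm_apply_apply x] at this

end SumOfCopies

/-! ### Finiteness of the space of fixed vectors -/

section FixedVectors

variable {G : Type*} [Group G]

theorem mem_fixedVectors {k X : Type*} [CommRing k] [AddCommGroup X] [Module k X]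
    {ρ : Representation k G X} {L : Subgroup G} {v : X} :
    v ∈ fixedVectors ρ L ↔ ∀ l ∈ L, ρ l v = v :=
  ⟨fun h l hl => h ⟨l, hl⟩, fun h l => h l l.2⟩

theorem Representation.IntertwiningMap.apply_mem_fixedVectors {k X Y : Type*} [CommRing k]
    [AddCommGroup X] [Module k X] [AddCommGroup Y] [Module k Y] {ρ : Representation k G X}
    {σ : Representation k G Y} (f : ρ.IntertwiningMap σ) {L : Subgroup G} {v : X}
    (hv : v ∈ fixedVectors ρ L) : f v ∈ fixedVectors σ L :=
  mem_fixedVectors.2 fun l hl => by rw [← f.isIntertwining, mem_fixedVectors.1 hv l hl]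

theorem finite_fixedVectors_of_injective {k X Y : Type*} [Field k]
    [AddCommGroup X] [Module k X] [AddCommGroup Y] [Module k Y] {ρ : Representation k G X}
    {σ : Representation k G Y} (f : ρ.IntertwiningMap σ) (hf : Function.Injective f)
    {L : Subgroup G} (h : Module.Finite k (fixedVectors σ L)) :
    Module.Finite k (fixedVectors ρ L) :=
  Module.Finite.of_injective
    (f.toLinearMap.restrict fun _ hv => f.apply_mem_fixedVectors hv : fixedVectors ρ L →ₗ[k] _)
    fun _ _ h => Subtype.ext (hf (congrArg Subtype.val h))

/-- `G` acts on each coordinate along a basis of `B` separately, so the coordinates of an `L`-fixed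
vector are `L`-fixed: it lies in the image of `B ⊗ X^L`. -/
theorem finite_fixedVectors_baseChangeRep {K B X : Type*} [CommRing K] [Field B] [Algebra K B]
    [Module.Free K B] [AddCommGroup X] [Module K X] (ρ : Representation K G X) {L : Subgroup G}
    (h : Module.Finite K (fixedVectors ρ L)) :
    Module.Finite B (fixedVectors (baseChangeRep B ρ) L) := by
  classical
  let b := Module.Free.chooseBasis K B
  let e := TensorProduct.equivFinsuppOfBasisLeft (N := X) b
  refine Submodule.finiteDimensional_of_le
    (S₂ := LinearMap.range ((fixedVectors ρ L).subtype.baseChange B)) fun x hx => ?_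
  have hex : ∀ i, e x i ∈ fixedVectors ρ L := fun i => mem_fixedVectors.2 fun l hl => by
    rw [← equivFinsuppOfBasisLeft_baseChange b (ρ l)]
    exact DFunLike.congr_fun (congrArg e (mem_fixedVectors.1 hx l hl)) i
  rw [← e.symm_apply_apply x, TensorProduct.equivFinsuppOfBasisLeft_symm_apply]
  exact sum_mem fun i _ => ⟨b i ⊗ₜ ⟨e x i, hex i⟩, by simp⟩

end FixedVectors

/-! ### Simplicity of the fixed vectors over the Hecke algebra -/

section HeckeSimple

variable {G : Type*} [Group G] {B : Type*} {X : Type*} [AddCommGroup X]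

theorem apply_apply_out [CommRing B] [Module B X] (σ : Representation B G X) {L : Subgroup G}
    {v : X} (hv : v ∈ fixedVectors σ L) (g : G) (q : G ⧸ L) :
    σ g (σ q.out v) = σ (g • q).out v := by
  have h : g • q = QuotientGroup.mk (g * q.out) := by
    conv_lhs => rw [← QuotientGroup.out_eq' q]
    rfl
  obtain ⟨l, hl⟩ := QuotientGroup.mk_out_eq_mul L (g * q.out)
  rw [h, hl, map_mul, map_mul, Module.End.mul_apply, Module.End.mul_apply,
    mem_fixedVectors.1 hv l l.2]

/-- As `v` is `L`-fixed, `G` permutes the vectors `σ q.out v` as it permutes `G ⧸ L`. Their span is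
thus `G`-stable, and it contains `v`. -/
theorem exists_linearCombination_out_eq [Field B] [Module B X] (σ : Representation B G X)
    [σ.IsIrreducible] {L : Subgroup G} {v : X} (hv : v ∈ fixedVectors σ L) (h0 : v ≠ 0) (w : X) :
    ∃ c : G ⧸ L →₀ B, Finsupp.linearCombination B (fun q : G ⧸ L => σ q.out v) c = w := by
  have h := (σ.isIrreducible_iff_forall_submodule.1 inferInstance).2
    (Submodule.span B (Set.range fun q : G ⧸ L => σ q.out v)) fun g u hu => by
      induction hu using Submodule.span_induction with
      | mem u hu =>
        obtain ⟨q, rfl⟩ := hu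
        exact Submodule.subset_span ⟨g • q, (apply_apply_out σ hv g q).symm⟩
      | zero => simp
      | add a b _ _ ha hb => rw [map_add]; exact add_mem ha hb
      | smul r a _ ha => rw [map_smul]; exact Submodule.smul_mem _ r ha
  have hw : w ∈ Submodule.span B (Set.range fun q : G ⧸ L => σ q.out v) := by
    refine (h.resolve_left fun h => h0 ?_) ▸ Submodule.mem_top
    have hmem : σ (QuotientGroup.mk 1 : G ⧸ L).out v ∈
        Submodule.span B (Set.range fun q : G ⧸ L => σ q.out v) :=
      Submodule.subset_span ⟨_, rfl⟩
    obtain ⟨l, hl⟩ := QuotientGroup.mk_out_eq_mul L 1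
    rwa [h, Submodule.mem_bot, hl, one_mul, mem_fixedVectors.1 hv l l.2] at hmem
  rwa [← Finsupp.range_linearCombination] at hw

/-- The sum of the translates of a finitely supported function on `G / L` by representatives of
`L / N`, where `N` fixes the support pointwise. -/
noncomputable def HeckeAlgebra.sumTranslates [CommRing B] {L : Subgroup G} (c : G ⧸ L →₀ B)
    (N : Subgroup L) [Finite (L ⧸ N)] (hN : ∀ n ∈ N, ∀ q ∈ c.support, (n : G) • q = q) :
    HeckeAlgebra B L :=
  ⟨fun x => cosetSum N fun l : L => c ((l : G)⁻¹ • (QuotientGroup.mk x : G ⧸ L)), by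
    -- Invariance also holds off the support: if `n⁻¹ • q` were in the support, `n` would fix it,
    -- and it would equal `q`.
    have hc : ∀ n ∈ N, ∀ q, c ((n : G)⁻¹ • q) = c q := by
      intro n hn q
      by_cases hq : q ∈ c.support
      · rw [inv_smul_eq_iff.2 (hN n hn q hq).symm]
      · rw [Finsupp.notMem_support_iff.1 hq, ← Finsupp.notMem_support_iff]
        intro h
        have := hN n hn _ h
        rw [smul_inv_smul] at this
        exact hq (this ▸ h)
    refine ⟨fun l hl x => ?_, fun x l hl => ?_, ?_⟩
    · beta_reduce
      rw [← cosetSum_translate N (φ := fun m : L => c ((m : G)⁻¹ • (QuotientGroup.mk x : G ⧸ L)))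
        (fun m n hn => ?_) ⟨l, hl⟩⁻¹]
      · congr 1
        funext m
        congr 1
        simp only [Subgroup.coe_mul, mul_inv_rev, Subgroup.coe_inv, inv_inv, mul_smul]
        rfl
      · rw [Subgroup.coe_mul, mul_inv_rev, mul_smul, hc n hn]
    · beta_reduce
      rw [show (QuotientGroup.mk (x * l) : G ⧸ L) = QuotientGroup.mk x from
        QuotientGroup.mk_mul_of_mem x hl]
    · refine (Set.finite_iUnion fun γ : L ⧸ N =>
        c.support.finite_toSet.image fun q => (γ.out : G) • q).subset ?_
      rintro _ ⟨x, hx, rfl⟩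
      obtain ⟨γ, hγ⟩ : ∃ γ : L ⧸ N, c ((γ.out : G)⁻¹ • (QuotientGroup.mk x : G ⧸ L)) ≠ 0 := by
        by_contra! h
        exact hx ((finsum_congr h).trans finsum_zero)
      exact Set.mem_iUnion.2 ⟨γ, _, Finsupp.mem_support_iff.2 hγ, smul_inv_smul _ _⟩⟩

/-- Let `w` be the linear combination. After the sums over `G ⧸ L` and `L ⧸ N` are exchanged, the
term of `γ` is `σ γ.out w`, which is `w` because `w` is `L`-fixed. -/
theorem HeckeAlgebra.act_sumTranslates [CommRing B] [Module B X] (σ : Representation B G X)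
    {L : Subgroup G} (c : G ⧸ L →₀ B) (N : Subgroup L) [Finite (L ⧸ N)]
    (hN : ∀ n ∈ N, ∀ q ∈ c.support, (n : G) • q = q) {v : X} (hv : v ∈ fixedVectors σ L)
    (hw : Finsupp.linearCombination B (fun q : G ⧸ L => σ q.out v) c ∈ fixedVectors σ L) :
    act σ (sumTranslates c N hN) v =
      Nat.card (L ⧸ N) • Finsupp.linearCombination B (fun q : G ⧸ L => σ q.out v) c := by
  classical
  have := Fintype.ofFinite (L ⧸ N)
  have h1 : ∀ q : G ⧸ L, sumTranslates c N hN q.out • σ q.out v =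
      ∑ γ : L ⧸ N, c ((γ.out : G)⁻¹ • q) • σ q.out v := by
    intro q
    rw [← Finset.sum_smul]
    congr 1
    change cosetSum N (fun l : L => c ((l : G)⁻¹ • (QuotientGroup.mk q.out : G ⧸ L))) = _
    rw [QuotientGroup.out_eq']
    exact finsum_eq_sum_of_fintype _
  have h2 : ∀ γ : L ⧸ N, ∑ᶠ q : G ⧸ L, c ((γ.out : G)⁻¹ • q) • σ q.out v =
      Finsupp.linearCombination B (fun q : G ⧸ L => σ q.out v) c := by
    intro γ
    rw [← finsum_comp_equiv (MulAction.toPerm (γ.out : G) : Equiv.Perm (G ⧸ L))]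
    simp only [MulAction.toPerm_apply, inv_smul_smul, ← apply_apply_out σ hv]
    rw [finsum_eq_sum_of_support_subset (s := c.support) _ fun q hq => ?_]
    · conv_rhs => rw [← mem_fixedVectors.1 hw γ.out γ.out.2]
      rw [Finsupp.linearCombination_apply, Finsupp.sum, map_sum]
      simp only [map_smul]
    · refine Finsupp.mem_support_iff.2 fun h => hq ?_
      simp [h]
  unfold act cosetSum
  rw [finsum_congr h1, finsum_sum_comm]
  · rw [Finset.sum_congr rfl fun γ _ => h2 γ]
    simp
  · intro γ _
    refine (c.support.finite_toSet.image fun q => (γ.out : G) • q).subset fun q hq => ?_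
    refine ⟨(γ.out : G)⁻¹ • q, Finsupp.mem_support_iff.2 fun h => hq ?_, smul_inv_smul _ _⟩
    simp [h]

/-- `G ⧸ L` is discrete, so each point stabilizer in `L` is open. A finite intersection of them is
open, hence of finite index in the compact group `L`. -/
theorem finite_quotient_fixingSubgroup [TopologicalSpace G] [IsTopologicalGroup G]
    {L : Subgroup G} (hLo : IsOpen (L : Set G)) (hLc : IsCompact (L : Set G))
    (s : Finset (G ⧸ L)) : Finite (L ⧸ fixingSubgroup L (s : Set (G ⧸ L))) := by
  have : CompactSpace L := isCompact_iff_compactSpace.1 hLc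
  have : DiscreteTopology (G ⧸ L) := QuotientGroup.discreteTopology hLo
  refine Subgroup.quotient_finite_of_isOpen _ ?_
  have h : (fixingSubgroup L (s : Set (G ⧸ L)) : Set L) = ⋂ q ∈ s, {l : L | (l : G) • q = q} := by
    ext l
    simp only [SetLike.mem_coe, mem_fixingSubgroup_iff, Set.mem_iInter]
    rfl
  rw [h]
  refine isOpen_biInter_finset fun q _ => ?_
  have hc : Continuous fun l : L => (l : G) • q := continuous_subtype_val.smul continuous_const
  exact (isOpen_discrete {q}).preimage hc

/-- Any nonzero `v ∈ X^L` generates: write `w ∈ X^L` as a combination of translates of `v` and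
average the coefficients over `L`. The result is a Hecke operator sending `v` to a positive integer
multiple of `w`, and characteristic 0 permits the division. -/
theorem isSimpleModule_fixedVectors [Field B] [CharZero B] [Module B X] [TopologicalSpace G]
    [IsTopologicalGroup G] (σ : Representation B G X) [σ.IsIrreducible]
    {L : Subgroup G} (hLo : IsOpen (L : Set G)) (hLc : IsCompact (L : Set G))
    (hne : fixedVectors σ L ≠ ⊥) :
    IsSimpleModule (HeckeAlgebra B L) (fixedVectors σ L) := by
  rw [isSimpleModule_iff_toSpanSingleton_surjective]
  refine ⟨(Submodule.nontrivial_iff_ne_bot).2 hne, fun v hv w => ?_⟩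
  obtain ⟨c, hc⟩ := exists_linearCombination_out_eq σ v.2 (fun h => hv (Subtype.ext h)) w
  let N := fixingSubgroup L (c.support : Set (G ⧸ L))
  have hfin : Finite (L ⧸ N) := finite_quotient_fixingSubgroup hLo hLc c.support
  have hN : ∀ n ∈ N, ∀ q ∈ c.support, (n : G) • q = q :=
    fun n hn q hq => (mem_fixingSubgroup_iff L).1 hn q hq
  refine ⟨(Nat.card (L ⧸ N) : B)⁻¹ • HeckeAlgebra.sumTranslates c N hN, Subtype.ext ?_⟩
  have hcard : (Nat.card (L ⧸ N) : B) ≠ 0 := Nat.cast_ne_zero.2 Nat.card_pos.ne'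
  change HeckeAlgebra.act σ
    ((Nat.card (L ⧸ N) : B)⁻¹ • HeckeAlgebra.sumTranslates c N hN) (v : X) = w
  rw [HeckeAlgebra.smul_act, HeckeAlgebra.act_sumTranslates σ c N hN v.2 (hc ▸ w.2), hc,
    ← Nat.cast_smul_eq_nsmul B, inv_smul_smul₀ hcard]

end HeckeSimple

/-! ### Maximal subfields and commutants -/

/-- A maximal subfield is its own centralizer. With `Z` the centralizer of `S ∪ {d}`, the center `T`
of `Z` is commutative, closed under inverses and contains `S ∪ {d}`; it is a field, so it equals
`S`. -/
theorem Subring.mem_of_maximal_isField {D : Type*} [Ring D] (hD : ∀ d : D, d ≠ 0 → IsUnit d)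
    {S : Subring D} (hS : Maximal (fun T : Subring D => IsField T) S) {d : D}
    (hd : ∀ s ∈ S, s * d = d * s) : d ∈ S := by
  have hScomm : ∀ s ∈ S, ∀ t ∈ S, s * t = t * s := fun s hs t ht =>
    congrArg Subtype.val (hS.prop.mul_comm ⟨s, hs⟩ ⟨t, ht⟩)
  let Z := Subring.centralizer (insert d (S : Set D))
  let T := Z ⊓ Subring.centralizer (Z : Set D)
  have hZ : insert d (S : Set D) ⊆ Z := by
    intro x hx
    refine Subring.mem_centralizer_iff.2 fun y hy => ?_
    rcases hx with rfl | hx <;> rcases hy with rfl | hy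
    · rfl
    · exact hd y hy
    · exact (hd x hx).symm
    · exact hScomm y hy x hx
  have hT : insert d (S : Set D) ⊆ T := fun x hx => ⟨hZ hx,
    Subring.mem_centralizer_iff.2 fun y hy => (Subring.mem_centralizer_iff.1 hy x hx).symm⟩
  have hinv : ∀ (s : Set D) (u : Dˣ), (u : D) ∈ Subring.centralizer s →
      ((u⁻¹ : Dˣ) : D) ∈ Subring.centralizer s := fun s u hu =>
    Subring.mem_centralizer_iff.2 fun y hy =>
      (Commute.units_inv_right (Subring.mem_centralizer_iff.1 hu y hy : Commute y u)).eq
  have hTf : IsField T := by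
    obtain ⟨a, b, hab⟩ := hS.prop.exists_pair_ne
    refine ⟨⟨⟨a, hT (Or.inr a.2)⟩, ⟨b, hT (Or.inr b.2)⟩, fun h => hab ?_⟩,
      fun x y => Subtype.ext (Subring.mem_centralizer_iff.1 y.2.2 x x.2.1), fun {x} hx => ?_⟩
    · exact Subtype.ext (Subtype.mk.inj h)
    · obtain ⟨u, hu⟩ := hD x fun h => hx (Subtype.ext h)
      refine ⟨⟨(u⁻¹ : Dˣ), hinv _ u (hu ▸ x.2.1), hinv _ u (hu ▸ x.2.2)⟩, Subtype.ext ?_⟩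
      change (x : D) * (u⁻¹ : Dˣ) = 1
      rw [← hu, Units.mul_inv]
  exact hS.le_of_ge hTf (fun x hx => hT (Or.inr hx)) (hT (Or.inl rfl))

/-- `EndCenter ρ` carries only a commutative ring structure; this supplies the bases that the base
change arguments use. -/
theorem IsField.module_free {K M : Type*} [CommRing K] (hK : IsField K) [AddCommGroup M]
    [Module K M] : Module.Free K M := by
  let := hK.toField
  exact Module.Free.of_divisionRing K M

section Commutant

open Representation

variable {G : Type*} [Group G] {k : Type uB} [Field k] {X : Type uX} [AddCommGroup X] [Module k X]

/-- The density argument applied to the operators of `G` alone. -/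
theorem isAbsolutelyIrreducible_of_commutant (ρ : Representation k G X) [hρ : ρ.IsIrreducible]
    (hcomm : ∀ φ : Module.End k X, (∀ g v, φ (ρ g v) = ρ g (φ v)) → ∃ c : k, ∀ v, φ v = c • v) :
    IsAbsolutelyIrreducible.{uE} ρ := by
  intro E _ _
  obtain ⟨hX, hρ⟩ := ρ.isIrreducible_iff_forall_submodule.1 hρ
  refine (isIrreducible_iff_forall_submodule _).2 ⟨?_, fun W hW => ?_⟩
  · exact (Module.FaithfullyFlat.tensorProduct_mk_injective (A := k) (B := E) X).nontrivial
  · refine W.eq_bot_or_eq_top_of_baseChange_mem (Set.range ρ) (fun U hU => ?_) (fun φ hφ => ?_) ?_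
    · exact hρ U fun g => hU _ ⟨g, rfl⟩
    · exact hcomm φ fun g => hφ _ ⟨g, rfl⟩
    · rintro _ ⟨g, rfl⟩ x hx
      exact hW g x hx

end Commutant

/-! ### The division algebra of endomorphisms and its center -/

section EndRep

open Representation

variable {A : Type uA} [Field A] {G : Type uG} [Group G] {V : Type uV} [AddCommGroup V]
  [Module A V] (ρ : Representation A G V)

namespace EndRep

theorem incl_injective : Function.Injective (EndRep.incl ρ) := Subtype.val_injective

theorem incl_apply_apply (d : EndRep ρ) (g : G) (v : V) :
    EndRep.incl ρ d (ρ g v) = ρ g (EndRep.incl ρ d v) :=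
  (LinearMap.congr_fun (Subalgebra.mem_centralizer_iff A |>.1 d.2 (ρ g) ⟨g, rfl⟩) v).symm

theorem exists_incl_eq (φ : Module.End A V) (h : ∀ g v, φ (ρ g v) = ρ g (φ v)) :
    ∃ d : EndRep ρ, EndRep.incl ρ d = φ :=
  ⟨⟨φ, (Subalgebra.mem_centralizer_iff A).2 fun _ ⟨g, hg⟩ => hg ▸ LinearMap.ext fun v =>
    (h g v).symm⟩, rfl⟩

theorem isUnit_of_ne_zero [ρ.IsIrreducible] {d : EndRep ρ} (hd : d ≠ 0) : IsUnit d := by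
  let f : ρ.IntertwiningMap ρ :=
    ⟨EndRep.incl ρ d, fun g => LinearMap.ext fun v => incl_apply_apply ρ d g v⟩
  have hf : Function.Bijective f := (IsIrreducible.bijective_or_eq_zero f).resolve_right fun h =>
    hd (incl_injective ρ ((congrArg IntertwiningMap.toLinearMap h).trans (map_zero _).symm))
  let e := f.ofBijective hf
  obtain ⟨d', hd'⟩ := exists_incl_eq ρ e.symm.toLinearMap
    fun g v => e.symm.toIntertwiningMap.isIntertwining _ _ g v
  refine ⟨⟨d, d', incl_injective ρ ?_, incl_injective ρ ?_⟩, rfl⟩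
  · rw [map_mul, map_one, hd']
    exact LinearMap.ext fun v => e.toLinearEquiv.apply_symm_apply v
  · rw [map_mul, map_one, hd']
    exact LinearMap.ext fun v => e.toLinearEquiv.symm_apply_apply v

/-- Evaluation at a nonzero `v ∈ V^L` lands in `V^L` and is injective, since a unit cannot kill `v`.
-/
theorem finite [ρ.IsIrreducible] {L : Subgroup G} (hne : fixedVectors ρ L ≠ ⊥)
    (hfin : Module.Finite A (fixedVectors ρ L)) : Module.Finite A (EndRep ρ) := by
  obtain ⟨v, hv, hv0⟩ := Submodule.exists_mem_ne_zero_of_ne_bot hne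
  let f : EndRep ρ →ₗ[A] fixedVectors ρ L :=
    { toFun := fun d => ⟨EndRep.incl ρ d v, mem_fixedVectors.2 fun l hl => by
        rw [← incl_apply_apply, mem_fixedVectors.1 hv l hl]⟩
      map_add' := fun d d' => Subtype.ext (by simp)
      map_smul' := fun a d => Subtype.ext (by simp) }
  refine Module.Finite.of_injective f ((injective_iff_map_eq_zero f).2 fun d hd => ?_)
  by_contra h
  obtain ⟨u, rfl⟩ := isUnit_of_ne_zero ρ h
  refine hv0 ?_
  have h1 : EndRep.incl ρ (u : EndRep ρ) v = 0 := congrArg Subtype.val hd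
  have h2 : EndRep.incl ρ ((u⁻¹ : (EndRep ρ)ˣ) * u : EndRep ρ) v = v := by
    rw [Units.inv_mul, map_one]; rfl
  rw [← h2, map_mul, Module.End.mul_apply, h1, map_zero]

end EndRep

namespace EndCenter

theorem incl_injective : Function.Injective (EndCenter.incl ρ) := Subtype.val_injective

theorem incl_mul_comm (c : EndCenter ρ) (d : EndRep ρ) :
    EndCenter.incl ρ c * d = d * EndCenter.incl ρ c :=
  (Subalgebra.mem_center_iff.1 c.2 d).symm

theorem exists_incl_eq {d : EndRep ρ} (h : ∀ d', d' * d = d * d') :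
    ∃ c : EndCenter ρ, EndCenter.incl ρ c = d :=
  ⟨⟨d, Subalgebra.mem_center_iff.2 h⟩, rfl⟩

theorem isField [hρ : ρ.IsIrreducible] : IsField (EndCenter ρ) := by
  have := (ρ.isIrreducible_iff_forall_submodule.1 hρ).1
  refine ⟨⟨0, 1, fun h => ?_⟩, mul_comm, fun {c} hc => ?_⟩
  · obtain ⟨v, hv⟩ := exists_ne (0 : V)
    refine hv ?_
    have h1 : (1 : EndCenter ρ) • v = 0 := by rw [← h, zero_smul]
    rwa [one_smul] at h1
  · obtain ⟨u, hu⟩ := EndRep.isUnit_of_ne_zero ρ (d := EndCenter.incl ρ c)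
      fun h => hc (incl_injective ρ (h.trans (map_zero _).symm))
    obtain ⟨c', hc'⟩ := exists_incl_eq ρ (d := ((u⁻¹ : (EndRep ρ)ˣ) : EndRep ρ)) fun d =>
      (Commute.units_inv_right ((hu ▸ incl_mul_comm ρ c d).symm : Commute d u)).eq
    exact ⟨c', incl_injective ρ (by rw [map_mul, map_one, hc', ← hu, Units.mul_inv])⟩

end EndCenter

theorem extRep_forall_submodule [hρ : ρ.IsIrreducible] (W : Submodule (EndCenter ρ) V)
    (hW : ∀ g, ∀ v ∈ W, ρ g v ∈ W) : W = ⊥ ∨ W = ⊤ := by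
  refine ((ρ.isIrreducible_iff_forall_submodule.1 hρ).2 (W.restrictScalars A) hW).imp
    (fun h => ?_) (fun h => ?_)
  · simpa using h
  · simpa using h

theorem IsSmoothRep.extRep [TopologicalSpace G] (h : IsSmoothRep ρ) : IsSmoothRep (extRep ρ) := h

theorem finite_fixedVectors_extRep {L : Subgroup G} (h : Module.Finite A (fixedVectors ρ L)) :
    Module.Finite (EndCenter ρ) (fixedVectors (extRep ρ) L) := by
  obtain ⟨s, hs⟩ := Module.Finite.iff_fg.1 h
  refine Module.Finite.iff_fg.2 ⟨s, le_antisymm (Submodule.span_le.2 fun v hv => ?_) fun v hv => ?_⟩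
  · have : v ∈ fixedVectors ρ L := hs ▸ Submodule.subset_span hv
    exact mem_fixedVectors.2 fun l hl => mem_fixedVectors.1 this l hl
  · have : v ∈ Submodule.span A (s : Set V) := by
      rw [hs]
      exact mem_fixedVectors.2 fun l hl => mem_fixedVectors.1 hv l hl
    exact Submodule.span_le_restrictScalars A (EndCenter ρ) _ this

/-- An endomorphism commuting with `G`, as an endomorphism over the center. -/
noncomputable def EndRep.toEndCenterEnd (d : EndRep ρ) : Module.End (EndCenter ρ) V where
  toFun := EndRep.incl ρ d
  map_add' := map_add _
  map_smul' c v := by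
    rw [RingHom.id_apply, EndCenter.smul_def, EndCenter.smul_def, ← Module.End.mul_apply,
      ← map_mul, ← EndCenter.incl_mul_comm, map_mul, Module.End.mul_apply]

/-- The density argument for the operators of `G` and `D` together: commuting with `G` puts an
operator in `D`, and commuting with `D` puts it in the center. -/
theorem extBaseChange_eq_bot_or_eq_top [ρ.IsIrreducible] {B : Type uB} [Field B]
    [Algebra (EndCenter ρ) B] (W : Submodule B (B ⊗[EndCenter ρ] V))
    (hG : ∀ g, ∀ x ∈ W, extBaseChange ρ B g x ∈ W)
    (hD : ∀ d : EndRep ρ, ∀ x ∈ W, d.toEndCenterEnd.baseChange B x ∈ W) : W = ⊥ ∨ W = ⊤ := by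
  have := (EndCenter.isField ρ).module_free (M := B)
  refine W.eq_bot_or_eq_top_of_baseChange_mem
    (Set.range (extRep ρ) ∪ Set.range (EndRep.toEndCenterEnd ρ)) (fun U hU => ?_)
    (fun φ hφ => ?_) ?_
  · exact extRep_forall_submodule ρ U fun g => hU _ (Or.inl ⟨g, rfl⟩)
  · obtain ⟨d, hd⟩ := EndRep.exists_incl_eq ρ (φ.restrictScalars A) fun g =>
      hφ _ (Or.inl ⟨g, rfl⟩)
    obtain ⟨c, hc⟩ := EndCenter.exists_incl_eq ρ (d := d) fun d' => EndRep.incl_injective ρ <|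
      LinearMap.ext fun v => by
        rw [map_mul, map_mul, hd]
        exact (hφ _ (Or.inr ⟨d', rfl⟩) v).symm
    exact ⟨c, fun v => by rw [EndCenter.smul_def, hc, hd]; rfl⟩
  · rintro _ (⟨g, rfl⟩ | ⟨d, rfl⟩) x hx
    · exact hG g x hx
    · exact hD d x hx

theorem one_tmul_ne_zero [ρ.IsIrreducible] (B : Type uB) [Field B]
    [Algebra (EndCenter ρ) B] {v : V} (hv : v ≠ 0) : (1 : B) ⊗ₜ[EndCenter ρ] v ≠ 0 := by
  have := (EndCenter.isField ρ).module_free (M := B)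
  have hinj := Module.FaithfullyFlat.tensorProduct_mk_injective (A := EndCenter ρ) (B := B) V
  exact fun h => hv (hinj (h.trans (TensorProduct.tmul_zero _ _).symm))

/-- The splitting criterion with cyclic vector `1 ⊗ v` and, as endomorphisms, a finite family `s`
spanning `D` over `A`. -/
theorem exists_isSumOfCopies_extBaseChange [hρ : ρ.IsIrreducible]
    (hfin : Module.Finite A (EndRep ρ)) (B : Type uB) [Field B] [Algebra (EndCenter ρ) B] :
    ∃ (X : Type (max uV uB)) (_ : AddCommGroup X) (_ : Module B X) (σ : Representation B G X),
      σ.IsIrreducible ∧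
      (∃ π : (extBaseChange ρ B).IntertwiningMap σ, Function.Surjective π) ∧
      ∃ n : ℕ, IsSumOfCopies (extBaseChange ρ B) σ n := by
  have := (ρ.isIrreducible_iff_forall_submodule.1 hρ).1
  obtain ⟨v, hv⟩ := exists_ne (0 : V)
  obtain ⟨n, s, hs⟩ := Module.Finite.exists_fin (R := A) (M := EndRep ρ)
  have : Nontrivial (B ⊗[EndCenter ρ] V) := ⟨_, _, one_tmul_ne_zero ρ B hv⟩
  have hcomm : ∀ (d : EndRep ρ) g x, d.toEndCenterEnd.baseChange B (extBaseChange ρ B g x) =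
      extBaseChange ρ B g (d.toEndCenterEnd.baseChange B x) := by
    intro d g x
    induction x with
    | zero => simp
    | add x y hx hy => simp only [map_add, hx, hy]
    | tmul b v => exact congrArg (b ⊗ₜ[EndCenter ρ] ·) (EndRep.incl_apply_apply ρ d g v)
  refine exists_isIrreducible_isSumOfCopies (extBaseChange ρ B) (v₀ := 1 ⊗ₜ v)
    (fun W hW hvW => ?_) (fun i => (s i).toEndCenterEnd.baseChange B) (fun i => hcomm (s i))
    (fun W hW hWt x hx => ?_)
  · refine W.eq_top_of_one_tmul_mem (Set.range (extRep ρ)) (fun U hU => ?_) ?_ hv hvW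
    · exact extRep_forall_submodule ρ U fun g => hU _ ⟨g, rfl⟩
    · rintro _ ⟨g, rfl⟩ x hx
      exact hW g x hx
  · have hall : ∀ d : EndRep ρ, d.toEndCenterEnd.baseChange B x ∈ W := by
      intro d
      have hd : d ∈ Submodule.span A (Set.range s) := hs ▸ Submodule.mem_top
      induction hd using Submodule.span_induction with
      | mem d hd => obtain ⟨i, rfl⟩ := hd; exact hx i
      | zero =>
        rw [show (0 : EndRep ρ).toEndCenterEnd = 0 from LinearMap.ext fun v => by
          simp [EndRep.toEndCenterEnd]]
        simp
      | add d d' _ _ h h' =>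
        rw [show (d + d').toEndCenterEnd = d.toEndCenterEnd + d'.toEndCenterEnd from
          LinearMap.ext fun v => by simp [EndRep.toEndCenterEnd]]
        rw [LinearMap.baseChange_add]
        exact add_mem h h'
      | smul a d _ h =>
        rw [show (a • d).toEndCenterEnd = algebraMap A (EndCenter ρ) a • d.toEndCenterEnd from
          LinearMap.ext fun v => by simp [EndRep.toEndCenterEnd]]
        rw [LinearMap.baseChange_smul]
        exact W.smul_of_tower_mem (algebraMap A (EndCenter ρ) a) h
    -- The largest `D`-stable subspace of `W`. It is also `G`-stable, and it is proper because `W`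
    -- is, so it vanishes.
    let U : Submodule B (B ⊗[EndCenter ρ] V) :=
      ⨅ d : EndRep ρ, W.comap (d.toEndCenterEnd.baseChange B)
    have hU : ∀ y, y ∈ U ↔ ∀ d : EndRep ρ, d.toEndCenterEnd.baseChange B y ∈ W := by
      simp [U]
    have hUbot : U = ⊥ := by
      refine (extBaseChange_eq_bot_or_eq_top ρ U (fun g y hy => (hU _).2 fun d => ?_)
        (fun d' y hy => (hU _).2 fun d => ?_)).resolve_right fun h => hWt (eq_top_iff.2 fun y _ => ?_)
      · rw [hcomm]
        exact hW g _ ((hU y).1 hy d)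
      · have := (hU y).1 hy (d * d')
        rwa [show (d * d').toEndCenterEnd = d.toEndCenterEnd * d'.toEndCenterEnd from
          LinearMap.ext fun v => by simp [EndRep.toEndCenterEnd], LinearMap.baseChange_mul] at this
      · have := (hU y).1 (h ▸ Submodule.mem_top) 1
        rwa [show (1 : EndRep ρ).toEndCenterEnd = 1 from
          LinearMap.ext fun v => by simp [EndRep.toEndCenterEnd], Module.End.one_eq_id,
          LinearMap.baseChange_id] at this
    exact (Submodule.mem_bot B).1 (hUbot ▸ (hU x).2 hall)

/-- Scalar multiplication `B ⊗ V → V` is a nonzero `G`-map onto an irreducible `B`-representation,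
so `σ` is isomorphic to `V`. Its endomorphisms are the elements of `D` centralizing `B`, which lie
in `B` by maximality. -/
theorem isAbsolutelyIrreducible_of_maximal_range [ρ.IsIrreducible] {B : Type uB} [Field B]
    [Algebra (EndCenter ρ) B] [Module B V] [IsScalarTower (EndCenter ρ) B V]
    (i : B →+* EndRep ρ) (hi : ∀ (b : B) (v : V), b • v = EndRep.incl ρ (i b) v)
    (hmax : Maximal (fun T : Subring (EndRep ρ) => IsField T) i.range)
    {X : Type uX} [AddCommGroup X] [Module B X] (σ : Representation B G X) [σ.IsIrreducible]
    {n : ℕ} (hσ : IsSumOfCopies (extBaseChange ρ B) σ n) :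
    IsAbsolutelyIrreducible.{uE} σ := by
  obtain ⟨hVn, hV⟩ := ρ.isIrreducible_iff_forall_submodule.1 ‹_›
  have hA : ∀ (a : A) (v : V),
      a • v = algebraMap (EndCenter ρ) B (algebraMap A (EndCenter ρ) a) • v := fun a v => by
    rw [algebraMap_smul, algebraMap_smul]
  let τ : Representation B G V :=
    { toFun := fun g =>
        { toFun := ρ g
          map_add' := map_add _
          map_smul' := fun b v => by
            rw [hi, hi, EndRep.incl_apply_apply, RingHom.id_apply] }
      map_one' := by ext v; simp
      map_mul' := fun g h => by ext v; simp }
  have hτ : τ.IsIrreducible := by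
    refine τ.isIrreducible_iff_forall_submodule.2 ⟨hVn, fun W hW => ?_⟩
    let W' : Submodule A V :=
      { W with smul_mem' := fun a v hv => by rw [hA]; exact W.smul_mem _ hv }
    have hmem : ∀ v, v ∈ W' ↔ v ∈ W := fun v => Iff.rfl
    refine (hV W' hW).imp (fun h => ?_) (fun h => ?_)
    · ext v
      rw [← hmem, h, Submodule.mem_bot, Submodule.mem_bot]
    · ext v
      rw [← hmem, h]
      simp
  let ψ : (extBaseChange ρ B).IntertwiningMap τ :=
    ⟨LinearMap.liftBaseChange B (LinearMap.id : V →ₗ[EndCenter ρ] V), fun g =>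
      LinearMap.ext fun x => by
        induction x with
        | zero => simp
        | add x y hx hy => rw [map_add, hx, hy, map_add]
        | tmul b v =>
          change LinearMap.liftBaseChange B LinearMap.id (b ⊗ₜ[EndCenter ρ] ρ g v) =
            τ g (LinearMap.liftBaseChange B LinearMap.id (b ⊗ₜ[EndCenter ρ] v))
          simp only [LinearMap.liftBaseChange_tmul, LinearMap.id_apply, map_smul]
          rfl⟩
  have hψ : ψ ≠ 0 := fun h => by
    obtain ⟨v, hv⟩ := exists_ne (0 : V)
    have h1 : ψ (1 ⊗ₜ v) = 0 := by rw [h]; rfl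
    have h2 : ψ (1 ⊗ₜ v) = (1 : B) • v := LinearMap.liftBaseChange_tmul ..
    exact hv (by rw [← one_smul B v, ← h2, h1])
  obtain ⟨e⟩ := hσ.nonempty_equiv ψ hψ
  have hsymm : ∀ v, e.toLinearEquiv (e.toLinearEquiv.symm v) = v := e.toLinearEquiv.apply_symm_apply
  have he : ∀ g x, e.toLinearEquiv (σ g x) = ρ g (e.toLinearEquiv x) := fun g x =>
    e.toIntertwiningMap.isIntertwining _ _ g x
  have he' : ∀ g v, e.toLinearEquiv.symm (ρ g v) = σ g (e.toLinearEquiv.symm v) := fun g v => by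
    rw [LinearEquiv.symm_apply_eq, he, hsymm]
  refine isAbsolutelyIrreducible_of_commutant σ fun φ hφ => ?_
  -- `φ` transported to `V`: an element `d` of `D` that commutes with `B`.
  let φ' : V →ₗ[B] V := e.toLinearEquiv.toLinearMap ∘ₗ φ ∘ₗ e.toLinearEquiv.symm.toLinearMap
  obtain ⟨d, hd⟩ := EndRep.exists_incl_eq ρ
    { toFun := φ', map_add' := map_add φ', map_smul' := fun a v => by
        rw [hA, map_smul, ← hA]; rfl } fun g v => by
      change e.toLinearEquiv (φ (e.toLinearEquiv.symm (ρ g v))) =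
        ρ g (e.toLinearEquiv (φ (e.toLinearEquiv.symm v)))
      rw [he', hφ, he]
  have hdv : ∀ v, EndRep.incl ρ d v = φ' v := fun v => LinearMap.congr_fun hd v
  have hmem : d ∈ i.range := by
    refine Subring.mem_of_maximal_isField (fun _ h => EndRep.isUnit_of_ne_zero ρ h) hmax ?_
    rintro _ ⟨b, rfl⟩
    refine EndRep.incl_injective ρ (LinearMap.ext fun v => ?_)
    rw [map_mul, map_mul, Module.End.mul_apply, Module.End.mul_apply, hdv, hdv, ← hi, ← hi,
      map_smul]
  obtain ⟨b, rfl⟩ := hmem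
  refine ⟨b, fun x => e.toLinearEquiv.injective ?_⟩
  have h := hdv (e.toLinearEquiv x)
  rw [← hi] at h
  rw [map_smul, h]
  change _ = e.toLinearEquiv (φ (e.toLinearEquiv.symm (e.toLinearEquiv x)))
  rw [LinearEquiv.symm_apply_apply]

end EndRep
-- The main theorem
theorem corollary5p4
    {A : Type uA} [Field A] [CharZero A]
    {G : Type uG} [Group G] [TopologicalSpace G] [IsLGroup G]
    (L : Subgroup G) (hLo : IsOpen (L : Set G)) (hLc : IsCompact (L : Set G))
    {V : Type uV} [AddCommGroup V] [Module A V] (ρ : Representation A G V)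
    (hsm : IsSmoothRep ρ) (hirr : ρ.IsIrreducible)
    (hne : fixedVectors ρ L ≠ ⊥) (hfin : Module.Finite A (fixedVectors ρ L)) :
    -- `D = End(V)` is a division ring with center a field `K`; `V` is a `(K, G)`-module;
    -- every maximal subfield of `D` contains `K`
    (∀ d : EndRep ρ, d ≠ 0 → IsUnit d) ∧
    IsField (EndCenter ρ) ∧
    IsSmoothRep (extRep ρ) ∧
    (∀ S : Subring (EndRep ρ), Maximal (fun T : Subring (EndRep ρ) => IsField T) S →
      Subring.center (EndRep ρ) ≤ S) ∧
    -- for every field extension `B` of `K` there is a module `X = V(B)`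
    ∀ (B : Type uB) [Field B] [Algebra (EndCenter ρ) B],
      ∃ (X : Type (max uV uB)) (_ : AddCommGroup X) (_ : Module B X)
        (σ : Representation B G X),
        IsSmoothRep σ ∧ σ.IsIrreducible ∧
        fixedVectors σ L ≠ ⊥ ∧
        Module.Finite B (fixedVectors σ L) ∧
        IsSimpleModule (HeckeAlgebra B L) (fixedVectors σ L) ∧
        (∃ n : ℕ, IsSumOfCopies (extBaseChange ρ B) σ n) ∧
        -- uniqueness up to isomorphism
        (∀ (Y : Type uY) [AddCommGroup Y] [Module B Y] (τ : Representation B G Y),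
          IsSmoothRep τ → τ.IsIrreducible →
          (∃ m : ℕ, IsSumOfCopies (extBaseChange ρ B) τ m) →
          Nonempty (τ.Equiv σ)) ∧
        -- if `B` is, through some `K`-embedding `i`, a maximal subfield of `D`
        (∀ i : B →+* EndRep ρ,
          (∀ c : EndCenter ρ, i (algebraMap (EndCenter ρ) B c) = EndCenter.incl ρ c) →
          Maximal (fun T : Subring (EndRep ρ) => IsField T) i.range →
          IsAbsolutelyIrreducible.{uE} σ) := by
  have hfinD := EndRep.finite ρ hne hfin
  have hunit : ∀ d : EndRep ρ, d ≠ 0 → IsUnit d := fun d hd => EndRep.isUnit_of_ne_zero ρ hd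
  refine ⟨hunit, EndCenter.isField ρ, hsm.extRep, fun S hS c hc => ?_, fun B _ _ => ?_⟩
  · exact Subring.mem_of_maximal_isField hunit hS fun s _ => Subring.mem_center_iff.1 hc s
  obtain ⟨X, _, _, σ, hσ, ⟨π, hπ⟩, n, hn⟩ := exists_isSumOfCopies_extBaseChange ρ hfinD B
  have : Module.Free (EndCenter ρ) B := (EndCenter.isField ρ).module_free
  -- Characteristic 0 passes along `A → K → B`; both maps are injective since `A` is a field and the
  -- target is nontrivial.
  have : CharZero B := charZero_of_injective_ringHom
    ((algebraMap (EndCenter ρ) B).comp (algebraMap A (EndCenter ρ))).injective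
  obtain ⟨v, hv, hv0⟩ := Submodule.exists_mem_ne_zero_of_ne_bot hne
  have hx0 := one_tmul_ne_zero ρ B hv0
  have hx : (1 : B) ⊗ₜ[EndCenter ρ] v ∈ fixedVectors (extBaseChange ρ B) L :=
    mem_fixedVectors.2 fun l hl =>
      congrArg (fun w => (1 : B) ⊗ₜ[EndCenter ρ] w) (mem_fixedVectors.1 hv l hl)
  have : Nontrivial (B ⊗[EndCenter ρ] V) := ⟨_, _, hx0⟩
  have hσne : fixedVectors σ L ≠ ⊥ := by
    obtain ⟨p, hp⟩ := hn.exists_apply_ne_zero hx0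
    exact (Submodule.ne_bot_iff _).2 ⟨_, p.apply_mem_fixedVectors hx, hp⟩
  obtain ⟨f, hf⟩ := hn.exists_injective
  refine ⟨X, inferInstance, inferInstance, σ, IsSmoothRep.of_surjective
    (hsm.extRep.baseChangeRep B) π hπ, hσ, hσne, ?_, isSimpleModule_fixedVectors σ hLo hLc hσne,
    ⟨n, hn⟩, fun Y _ _ τ _ hτ ⟨m, hm⟩ => ?_, fun i hi hmax => ?_⟩
  · exact finite_fixedVectors_of_injective f hf
      (finite_fixedVectors_baseChangeRep _ (finite_fixedVectors_extRep ρ hfin))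
  -- `B ⊗ V` is a sum of copies of `τ` and maps nontrivially to `σ`.
  · obtain ⟨p, hp⟩ := hn.exists_apply_ne_zero hx0
    exact hm.nonempty_equiv p fun h => hp (by rw [h]; rfl)
  -- `B` acts on `V` through `i`; the hypothesis `hi` makes this extend the action of the center.
  · let : Module B V := Module.compHom V (((EndRep.incl ρ).toRingHom).comp i)
    have hsmul : ∀ (b : B) (v : V), b • v = EndRep.incl ρ (i b) v := fun _ _ => rfl
    have : IsScalarTower (EndCenter ρ) B V := ⟨fun c b v => by
      rw [hsmul, hsmul, Algebra.smul_def, map_mul, hi, map_mul]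
      rfl⟩
    exact isAbsolutelyIrreducible_of_maximal_range ρ i hsmul hmax σ hn
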